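/- Let $P$ be a distribution on $\mathbb{R}^d$ with mean $x^*$ and (finite) covariance matrix $\preceq \sigma^2 I$, where $\sigma\ge 0$. Let $0<\alpha\le 0.33$, let $c_1>0$ with $c_1^2\ge \frac32$, and let $$n\;\ge\;160\cdot 3.2\cdot 10^4\,\frac{d\log d}{\alpha}+160\cdot 11.2\cdot 10^4\,\frac{d}{\alpha}.$$ Let $\tilde y_1,\dots,\tilde y_n$ be i.i.d. samples from $P$. An adversary inspects all the samples and replaces at most $\alpha n$ of them by arbitrary vectors, which gives the data $y_1,\dots,y_n\in\mathbb{R}^d$. Consider the problem $$\min_{x\in\mathbb{R}^d,\;h\in\mathbb{R}^n}\ \|h\|_0\quad\text{s.t.}\quad 0\le h_i\le 1\ \ \forall i,\qquad \lambda_{\max}\Big(\sum_{i=1}^n(1-h_i)(y_i-x)(y_i-x)^\top\Big)\le c_1^2\,n\,\sigma^2,\tag{obj}$$ where $\|h\|_0$ is the number of nonzero entries of $h$. Then, with probability at least $0.949$ over the samples, both of the following hold, whatever the adversary does. 1. Every globally optimal solution $(h^{\mathrm{opt}},x^{\mathrm{opt}})$ of (obj) such that $h^{\mathrm{opt}}_i\in\{0,1\}$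 for all $i$ and $x^{\mathrm{opt}}$ is the average of the points $y_i$ with $h^{\mathrm{opt}}_i=0$ satisfies $\|x^{\mathrm{opt}}-x^*\|_2\le(7.5+3.1c_1)\,\sigma\sqrt{\alpha}$. 2. Every feasible solution $(\hat h,\hat x)$ of (obj) such that $\hat h_i\in\{0,1\}$ for all $i$, $\hat x$ is the average of the points $y_i$ with $\hat h_i=0$, and $\|\hat h\|_0\le\frac{161}{160}\alpha n$ satisfies $\|\hat x-x^*\|_2\le(7.5+3.1c_1)\,\sigma\sqrt{\alpha}$. -/

import Mathlib

open MeasureTheory ProbabilityTheory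

noncomputable section

namespace RobustMean

/-- The covariance matrix of a distribution on `ℝ^d`. -/
def covMatrix {d : ℕ} (P : Measure (EuclideanSpace ℝ (Fin d))) : Matrix (Fin d) (Fin d) ℝ :=
  Matrix.of fun i j => covariance (fun z => z i) (fun z => z j) P

/-- The largest eigenvalue of a real symmetric matrix (of positive size). -/
def lambdaMax {d : ℕ} (A : Matrix (Fin d) (Fin d) ℝ) : ℝ :=
  sSup (spectrum ℝ A)

/-- The weighted scatter matrix `∑ i, (1 - h i) (y i - x) (y i - x)ᵀ`. -/
def scatter {n d : ℕ} (y : Fin n → EuclideanSpace ℝ (Fin d)) (h : Fin n → ℝ)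
    (x : EuclideanSpace ℝ (Fin d)) : Matrix (Fin d) (Fin d) ℝ :=
  ∑ i, (1 - h i) • Matrix.vecMulVec (WithLp.ofLp (y i - x)) (WithLp.ofLp (y i - x))

/-- `y` is an `α`-corrupted version of the sample `ytilde`: at most `α n` of the points have been
replaced, by arbitrary vectors. -/
def IsCorruption {n d : ℕ} (α : ℝ) (ytilde y : Fin n → EuclideanSpace ℝ (Fin d)) : Prop :=
  (Set.ncard {i | y i ≠ ytilde i} : ℝ) ≤ α * n

/-- `(h, x)` satisfies the constraints of the `ℓ₀` minimization problem with data `y`. -/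
def IsFeasible {n d : ℕ} (c₁ σ : ℝ) (y : Fin n → EuclideanSpace ℝ (Fin d)) (h : Fin n → ℝ)
    (x : EuclideanSpace ℝ (Fin d)) : Prop :=
  (∀ i, 0 ≤ h i ∧ h i ≤ 1) ∧ lambdaMax (scatter y h x) ≤ c₁ ^ 2 * n * σ ^ 2

/-- `(h, x)` is a global minimizer of `‖h‖₀` (the number of nonzero entries, `hammingNorm h`)
over all feasible pairs. -/
def IsGlobalOpt {n d : ℕ} (c₁ σ : ℝ) (y : Fin n → EuclideanSpace ℝ (Fin d)) (h : Fin n → ℝ)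
    (x : EuclideanSpace ℝ (Fin d)) : Prop :=
  IsFeasible c₁ σ y h x ∧ ∀ h' x', IsFeasible c₁ σ y h' x' → hammingNorm h ≤ hammingNorm h'

/-- All entries of `h` are `0` or `1`. -/
def IsBinary {n : ℕ} (h : Fin n → ℝ) : Prop := ∀ i, h i = 0 ∨ h i = 1

/-- `(∑ i, (1 - h i))⁻¹ • ∑ i, (1 - h i) • y i`; for binary `h` this is the average of the
points `y i` with `h i = 0`. -/
def inlierMean {n d : ℕ} (y : Fin n → EuclideanSpace ℝ (Fin d)) (h : Fin n → ℝ) :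
    EuclideanSpace ℝ (Fin d) :=
  Finset.univ.centerMass (fun i => 1 - h i) y

end RobustMean

end

/-!
The sample contains, with high probability, a large *stable* subset `S` (`IsStableSubset`): all but
`α n / 160` of the points, whose second-moment matrix about the mean `xstar`, normalized by
`n`, is at most `(3/2) σ² I` and whose deviations from `xstar` nearly cancel.

Stability implies the bounds for every adversary. Since `c₁² ≥ 3/2`, keeping the uncorrupted points
of `S` is feasible with center `xstar`, so a minimizer removes at most `(161/160) α n` points
(`IsStableSubset.hammingNorm_le`) and the first claim follows from the second. For the second, let
`K` be the set of kept points and `D` the set of uncorrupted points of `S` in `K`. Then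
`|D| (x - xstar)` is the sum of the deviations from `xstar` over `S`, minus that over `S \ D`, plus
the sum of the deviations from `x` over `K \ D`, because the deviations of all kept points from
their average cancel. The sets `S \ D` and `K \ D` have `O(α n)` points, so by Cauchy–Schwarz and
the two second-moment bounds these sums are `O(√α n σ)`, while `D` holds more than a third of the
sample (`IsStableSubset.norm_inlierMean_sub_le`).

To find `S`, deviations longer than `R = √(16000 d σ² / α)` are truncated to zero, and `S` is the
set of untruncated points. Markov's inequality bounds the number of truncated points and a
second-moment computation bounds the sum of the truncated deviations. The bound on their Gram matrix
is a matrix Chernoff bound, proved by a trace-power method that is elementary because the summands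
have rank one: starting from `A = u I` with `u = 3 n σ²`, each update changes the trace of the power
`p = N + 1` by at most `p (1 + ρ)^N zᵀ A^N z`, where `ρ u` bounds `‖z‖²`
(`trace_pow_add_vecMulVec_le`). By independence the expectation of the last factor is at most
`σ²` times that of `tr A^N`, so the expected trace of the power grows at most geometrically
(`integral_trace_pow_le`), and Markov's inequality with `p ≈ 20 log d + 80` finishes
(`measureReal_trace_pow_ge_le`, `chernoff_bound_le`).
-/

namespace RobustMean

/-! ### Powers of a symmetric matrix under rank-one updates -/

section TraceInequality

open Matrix

variable {m : Type*} [Fintype m]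

/-- Weighted Chebyshev inequality for moments: `i ↦ l i ^ j` and `i ↦ l i ^ k` are ordered in the
same way. -/
lemma moment_mul_le {l w : m → ℝ} (hl : ∀ i, 0 ≤ l i) (hw : ∀ i, 0 ≤ w i) (j k : ℕ) :
    (∑ i, w i * l i ^ j) * (∑ i, w i * l i ^ k) ≤ (∑ i, w i) * ∑ i, w i * l i ^ (j + k) := by
  have key : 0 ≤ ∑ a, ∑ b, w a * w b * ((l a ^ j - l b ^ j) * (l a ^ k - l b ^ k)) := by
    refine Finset.sum_nonneg fun a _ => Finset.sum_nonneg fun b _ =>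
      mul_nonneg (mul_nonneg (hw a) (hw b)) ?_
    rcases le_total (l a) (l b) with h | h
    · exact mul_nonneg_of_nonpos_of_nonpos
        (sub_nonpos.2 (pow_le_pow_left₀ (hl a) h _)) (sub_nonpos.2 (pow_le_pow_left₀ (hl a) h _))
    · exact mul_nonneg
        (sub_nonneg.2 (pow_le_pow_left₀ (hl b) h _)) (sub_nonneg.2 (pow_le_pow_left₀ (hl b) h _))
  have e : ∑ a, ∑ b, w a * w b * ((l a ^ j - l b ^ j) * (l a ^ k - l b ^ k))
      = 2 * ((∑ i, w i) * ∑ i, w i * l i ^ (j + k))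
        - 2 * ((∑ i, w i * l i ^ j) * (∑ i, w i * l i ^ k)) := by
    have e1 : ∀ a b, w a * w b * ((l a ^ j - l b ^ j) * (l a ^ k - l b ^ k))
        = (w a * l a ^ (j + k)) * w b + w a * (w b * l b ^ (j + k))
          - (w a * l a ^ j) * (w b * l b ^ k) - (w a * l a ^ k) * (w b * l b ^ j) := by
      intro a b; rw [pow_add, pow_add]; ring
    simp only [e1, Finset.sum_sub_distrib, Finset.sum_add_distrib, ← Finset.sum_mul_sum]
    ring
  linarith

variable {A : Matrix m m ℝ} {u : ℝ}

lemma le_eigenvalues {l : m → ℝ} (hu : ∀ v, u * (v ⬝ᵥ v) ≤ v ⬝ᵥ (A *ᵥ v))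
    (hl : ∀ i, ∃ v : m → ℝ, v ⬝ᵥ v = 1 ∧ v ⬝ᵥ (A *ᵥ v) = l i) (i : m) : u ≤ l i := by
  obtain ⟨v, hv, hv'⟩ := hl i
  simpa [hv, hv'] using hu v

variable [DecidableEq m]

/-- The spectral theorem in the form used below: traces of powers are power sums of the
eigenvalues `l`, the quadratic forms of the powers at a vector `z` are the moments of a nonnegative
measure on the eigenvalues, and each eigenvalue is a value of the quadratic form at a unit
vector. The eigenvalues make up the spectrum. -/
lemma exists_eigenvalue_moments (hA : A.IsHermitian) :
    ∃ l : m → ℝ, (∀ k : ℕ, (A ^ k).trace = ∑ i, l i ^ k) ∧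
      (∀ z : m → ℝ, ∃ w : m → ℝ, (∀ i, 0 ≤ w i) ∧
        ∀ k : ℕ, z ⬝ᵥ (A ^ k *ᵥ z) = ∑ i, w i * l i ^ k) ∧
      (∀ i, ∃ v : m → ℝ, v ⬝ᵥ v = 1 ∧ v ⬝ᵥ (A *ᵥ v) = l i) ∧ spectrum ℝ A = Set.range l := by
  set U : Matrix m m ℝ := (hA.eigenvectorUnitary : Matrix m m ℝ) with hU
  have hUs : star U = Uᵀ := by rw [star_eq_conjTranspose, conjTranspose_eq_transpose_of_trivial]
  have h1 : Uᵀ * U = 1 := by rw [← hUs]; exact Unitary.coe_star_mul_self _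
  set l := hA.eigenvalues with hl
  have hpow : ∀ k : ℕ, A ^ k = U * diagonal (fun i => l i ^ k) * Uᵀ := by
    intro k
    have h := hA.spectral_theorem
    conv_lhs => rw [h]
    rw [← map_pow, Unitary.conjStarAlgAut_apply, ← hU, diagonal_pow, hUs]
    rfl
  refine ⟨l, fun k => ?_, fun z => ⟨fun i => (Uᵀ *ᵥ z) i ^ 2, fun i => sq_nonneg _, fun k => ?_⟩,
    fun i => ⟨U *ᵥ Pi.single i 1, ?_, ?_⟩, hA.spectrum_real_eq_range_eigenvalues⟩
  · rw [hpow, Matrix.trace_mul_comm, ← Matrix.mul_assoc, h1, Matrix.one_mul, trace_diagonal]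
  · rw [hpow, ← mulVec_mulVec, ← mulVec_mulVec, dotProduct_mulVec, ← mulVec_transpose]
    simp only [dotProduct, mulVec_diagonal]
    exact Finset.sum_congr rfl fun i _ => by ring
  · rw [dotProduct_mulVec, ← mulVec_transpose, mulVec_mulVec, h1]
    simp
  · have hA1 : A = U * diagonal l * Uᵀ := by simpa using hpow 1
    rw [hA1, ← mulVec_mulVec, ← mulVec_mulVec, dotProduct_mulVec, ← mulVec_transpose,
      mulVec_mulVec _ Uᵀ U, h1]
    simp only [one_mulVec, single_dotProduct, mulVec_diagonal, one_mul, Pi.single_eq_same, mul_one]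

lemma quadForm_pow_nonneg (hA : A.IsHermitian) (h0 : 0 ≤ u)
    (hu : ∀ v, u * (v ⬝ᵥ v) ≤ v ⬝ᵥ (A *ᵥ v)) (z : m → ℝ) (k : ℕ) : 0 ≤ z ⬝ᵥ (A ^ k *ᵥ z) := by
  obtain ⟨l, -, hz, hl, -⟩ := exists_eigenvalue_moments hA
  obtain ⟨w, hw, hk⟩ := hz z
  rw [hk]
  exact Finset.sum_nonneg fun i _ =>
    mul_nonneg (hw i) (pow_nonneg (h0.trans (le_eigenvalues hu hl i)) _)

lemma mul_quadForm_pow_le (hA : A.IsHermitian) (h0 : 0 ≤ u)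
    (hu : ∀ v, u * (v ⬝ᵥ v) ≤ v ⬝ᵥ (A *ᵥ v)) (z : m → ℝ) (k : ℕ) :
    u * (z ⬝ᵥ (A ^ k *ᵥ z)) ≤ z ⬝ᵥ (A ^ (k + 1) *ᵥ z) := by
  obtain ⟨l, -, hz, hl, -⟩ := exists_eigenvalue_moments hA
  obtain ⟨w, hw, hk⟩ := hz z
  rw [hk, hk, Finset.mul_sum]
  refine Finset.sum_le_sum fun i _ => ?_
  have h1 := le_eigenvalues hu hl i
  have h2 := mul_nonneg (hw i) (pow_nonneg (h0.trans h1) k)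
  rw [pow_succ]
  nlinarith

lemma mul_trace_pow_le (hA : A.IsHermitian) (h0 : 0 ≤ u)
    (hu : ∀ v, u * (v ⬝ᵥ v) ≤ v ⬝ᵥ (A *ᵥ v)) (k : ℕ) :
    u * (A ^ k).trace ≤ (A ^ (k + 1)).trace := by
  obtain ⟨l, ht, -, hl, -⟩ := exists_eigenvalue_moments hA
  rw [ht, ht, Finset.mul_sum]
  refine Finset.sum_le_sum fun i _ => ?_
  have h1 := le_eigenvalues hu hl i
  have h2 := pow_nonneg (h0.trans h1) k
  rw [pow_succ]
  nlinarith

lemma trace_pow_nonneg (hA : A.IsHermitian) (h0 : 0 ≤ u)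
    (hu : ∀ v, u * (v ⬝ᵥ v) ≤ v ⬝ᵥ (A *ᵥ v)) (k : ℕ) : 0 ≤ (A ^ k).trace := by
  obtain ⟨l, ht, -, hl, -⟩ := exists_eigenvalue_moments hA
  rw [ht]
  exact Finset.sum_nonneg fun i _ => pow_nonneg (h0.trans (le_eigenvalues hu hl i)) _

lemma quadForm_mul_quadForm_le (hA : A.IsHermitian) (h0 : 0 ≤ u)
    (hu : ∀ v, u * (v ⬝ᵥ v) ≤ v ⬝ᵥ (A *ᵥ v)) (z : m → ℝ) (j k : ℕ) :
    (z ⬝ᵥ (A ^ j *ᵥ z)) * (z ⬝ᵥ (A ^ k *ᵥ z)) ≤ (z ⬝ᵥ z) * (z ⬝ᵥ (A ^ (j + k) *ᵥ z)) := by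
  obtain ⟨l, -, hz, hl, -⟩ := exists_eigenvalue_moments hA
  obtain ⟨w, hw, hk⟩ := hz z
  have e : z ⬝ᵥ z = ∑ i, w i := by simpa using hk 0
  rw [hk, hk, hk, e]
  exact moment_mul_le (fun i => h0.trans (le_eigenvalues hu hl i)) hw j k

/-- The trace of a power dominates the same power of each eigenvalue, so a bound on it bounds the
quadratic form. -/
lemma quadForm_le_of_trace_pow_lt (hA : A.IsHermitian) (hu : ∀ v, 0 ≤ v ⬝ᵥ (A *ᵥ v))
    {T : ℝ} (hT : 0 ≤ T) {p : ℕ} (h : (A ^ p).trace < T ^ p) (v : m → ℝ) :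
    v ⬝ᵥ (A *ᵥ v) ≤ T * (v ⬝ᵥ v) := by
  obtain ⟨l, ht, hz, hl, -⟩ := exists_eigenvalue_moments hA
  have hl0 : ∀ i, 0 ≤ l i := le_eigenvalues (by simpa using hu) hl
  obtain ⟨w, hw, hk⟩ := hz v
  have e0 : v ⬝ᵥ v = ∑ i, w i := by simpa using hk 0
  have e1 : v ⬝ᵥ (A *ᵥ v) = ∑ i, w i * l i := by simpa using hk 1
  rw [e0, e1, Finset.mul_sum]
  refine Finset.sum_le_sum fun i _ => ?_
  rw [mul_comm T]
  refine mul_le_mul_of_nonneg_left ?_ (hw i)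
  have h1 : l i ^ p < T ^ p := by
    refine lt_of_le_of_lt ?_ (ht p ▸ h)
    exact Finset.single_le_sum (f := fun i => l i ^ p) (fun i _ => pow_nonneg (hl0 i) _)
      (Finset.mem_univ i)
  exact (lt_of_pow_lt_pow_left₀ p hT h1).le

/-- Each factor `A + z zᵀ` in a mixed word costs at most a factor `1 + ρ`: expanding one of them
leaves `z` next to `z`, and the two quadratic forms recombine by Chebyshev's inequality. -/
lemma quadForm_mixed_le (hA : A.IsHermitian) (h0 : 0 ≤ u)
    (hu : ∀ v, u * (v ⬝ᵥ v) ≤ v ⬝ᵥ (A *ᵥ v)) {ρ : ℝ} (hρ : 0 ≤ ρ) {z : m → ℝ}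
    (hz : z ⬝ᵥ z ≤ ρ * u) (k j : ℕ) :
    z ⬝ᵥ (((A + vecMulVec z z) ^ k * A ^ j) *ᵥ z) ≤ (1 + ρ) ^ k * (z ⬝ᵥ (A ^ (k + j) *ᵥ z)) := by
  induction k generalizing j with
  | zero => simp
  | succ k ih =>
    have e : z ⬝ᵥ (((A + vecMulVec z z) ^ (k + 1) * A ^ j) *ᵥ z)
        = z ⬝ᵥ (((A + vecMulVec z z) ^ k * A ^ (j + 1)) *ᵥ z)
          + (z ⬝ᵥ (((A + vecMulVec z z) ^ k * A ^ 0) *ᵥ z)) * (z ⬝ᵥ (A ^ j *ᵥ z)) := by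
      rw [pow_succ (A + vecMulVec z z), Matrix.mul_assoc, Matrix.add_mul, Matrix.mul_add,
        ← pow_succ' A, Matrix.add_mulVec, dotProduct_add, pow_zero, Matrix.mul_one]
      congr 1
      rw [← mulVec_mulVec, ← mulVec_mulVec, vecMulVec_mulVec, mulVec_smul]
      simp [dotProduct_smul, mul_comm]
    have h1 := ih (j + 1)
    have h2 := mul_le_mul_of_nonneg_right (ih 0) (quadForm_pow_nonneg hA h0 hu z j)
    have h3 := quadForm_mul_quadForm_le hA h0 hu z k j
    have h4 := mul_le_mul_of_nonneg_right hz (quadForm_pow_nonneg hA h0 hu z (k + j))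
    have h5 := mul_le_mul_of_nonneg_left (mul_quadForm_pow_le hA h0 hu z (k + j)) hρ
    have hp : 0 ≤ (1 + ρ) ^ k := by positivity
    have h6 := mul_le_mul_of_nonneg_left (h3.trans (h4.trans (by linarith [h5]))) hp
      (c := ρ * (z ⬝ᵥ (A ^ (k + j + 1) *ᵥ z)))
    rw [e, show k + 1 + j = k + j + 1 by ring, pow_succ (1 + ρ)]
    rw [show k + (j + 1) = k + j + 1 by ring] at h1
    rw [add_zero] at h2
    nlinarith

/-- How a rank-one update changes the trace of a power, when the update is small compared with a
lower bound `u` on the spectrum. It plays the part of the Golden–Thompson inequality in the usual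
matrix Chernoff bounds. -/
lemma trace_pow_add_vecMulVec_le (hA : A.IsHermitian) (h0 : 0 ≤ u)
    (hu : ∀ v, u * (v ⬝ᵥ v) ≤ v ⬝ᵥ (A *ᵥ v)) {ρ : ℝ} (hρ : 0 ≤ ρ) {z : m → ℝ}
    (hz : z ⬝ᵥ z ≤ ρ * u) (N : ℕ) :
    ((A + vecMulVec z z) ^ (N + 1)).trace
      ≤ (A ^ (N + 1)).trace + (N + 1) * (1 + ρ) ^ N * (z ⬝ᵥ (A ^ N *ᵥ z)) := by
  -- trade the updated factors for factors `A` one at a time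
  have key : ∀ k j : ℕ, k + j = N + 1 → ((A + vecMulVec z z) ^ k * A ^ j).trace
      ≤ (A ^ (N + 1)).trace + k * ((1 + ρ) ^ N * (z ⬝ᵥ (A ^ N *ᵥ z))) := by
    intro k
    induction k with
    | zero => intro j hj; simp [show j = N + 1 by omega]
    | succ k ih =>
      intro j hj
      have e : ((A + vecMulVec z z) ^ (k + 1) * A ^ j).trace
          = ((A + vecMulVec z z) ^ k * A ^ (j + 1)).trace
            + z ⬝ᵥ (((A + vecMulVec z z) ^ k * A ^ j) *ᵥ z) := by
        rw [pow_succ' (A + vecMulVec z z), Matrix.mul_assoc, Matrix.add_mul, Matrix.trace_add,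
          Matrix.trace_mul_comm A, Matrix.mul_assoc, ← pow_succ A, vecMulVec_mul,
          trace_vecMulVec, dotProduct_comm, ← dotProduct_mulVec]
      have h1 := ih (j + 1) (by omega)
      have h2 := quadForm_mixed_le hA h0 hu hρ hz k j
      have hkj : k + j = N := by omega
      rw [hkj] at h2
      have h3 : (1 + ρ) ^ k * (z ⬝ᵥ (A ^ N *ᵥ z)) ≤ (1 + ρ) ^ N * (z ⬝ᵥ (A ^ N *ᵥ z)) :=
        mul_le_mul_of_nonneg_right (pow_le_pow_right₀ (by linarith) (by omega))
          (quadForm_pow_nonneg hA h0 hu z N)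
      rw [e]
      push_cast
      linarith
  have := key (N + 1) 0 rfl
  simp only [pow_zero, Matrix.mul_one] at this
  push_cast at this
  linarith

end TraceInequality

/-! ### Gram matrices of independent bounded vectors -/

section MatrixConcentration

open Matrix

variable {ι m : Type*} [DecidableEq m]

/-- The Gram-type matrix `u I + ∑ i ∈ s, (Y i) (Y i)ᵀ`. The shift `u I` keeps the spectrum
above `u`, so that each rank-one summand is a small relative perturbation. -/
noncomputable def shiftedGram (u : ℝ) (s : Finset ι) (Y : ι → m → ℝ) : Matrix m m ℝ :=
  u • (1 : Matrix m m ℝ) + ∑ i ∈ s, vecMulVec (Y i) (Y i)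

lemma isHermitian_shiftedGram (u : ℝ) (s : Finset ι) (Y : ι → m → ℝ) :
    (shiftedGram u s Y).IsHermitian := by
  ext b c
  simp [shiftedGram, Matrix.sum_apply, vecMulVec_apply, Matrix.one_apply, mul_comm, eq_comm]

lemma shiftedGram_insert [DecidableEq ι] (u : ℝ) {s : Finset ι} {a : ι} (ha : a ∉ s)
    (Y : ι → m → ℝ) :
    shiftedGram u (insert a s) Y = shiftedGram u s Y + vecMulVec (Y a) (Y a) := by
  rw [shiftedGram, shiftedGram, Finset.sum_insert ha, add_assoc, add_comm (vecMulVec _ _)]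

lemma shiftedGram_coe_sort (u : ℝ) (s : Finset ι) (Y : ι → m → ℝ) :
    shiftedGram u (Finset.univ : Finset s) (fun i => Y i) = shiftedGram u s Y := by
  rw [shiftedGram, shiftedGram, Finset.sum_coe_sort s (fun i => vecMulVec (Y i) (Y i))]

variable [Fintype m]

lemma quadForm_shiftedGram (u : ℝ) (s : Finset ι) (Y : ι → m → ℝ) (v : m → ℝ) :
    v ⬝ᵥ (shiftedGram u s Y *ᵥ v) = u * (v ⬝ᵥ v) + ∑ i ∈ s, (v ⬝ᵥ Y i) ^ 2 := by
  rw [shiftedGram, add_mulVec, dotProduct_add, smul_mulVec, one_mulVec, dotProduct_smul,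
    smul_eq_mul, sum_mulVec, dotProduct_sum]
  congr 1
  refine Finset.sum_congr rfl fun i _ => ?_
  rw [vecMulVec_mulVec]
  simp [dotProduct_comm (Y i) v, sq]

lemma le_quadForm_shiftedGram (u : ℝ) (s : Finset ι) (Y : ι → m → ℝ) (v : m → ℝ) :
    u * (v ⬝ᵥ v) ≤ v ⬝ᵥ (shiftedGram u s Y *ᵥ v) := by
  rw [quadForm_shiftedGram]
  exact le_add_of_nonneg_right (Finset.sum_nonneg fun i _ => sq_nonneg _)

lemma continuous_shiftedGram_pow (u : ℝ) (s : Finset ι) (k : ℕ) :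
    Continuous fun Y : ι → m → ℝ => shiftedGram u s Y ^ k := by
  unfold shiftedGram
  refine Continuous.pow (continuous_const.add (continuous_finsetSum _ fun i _ => ?_)) k
  exact Continuous.matrix_vecMulVec (continuous_apply i) (continuous_apply i)

/-- Pairing a positive semidefinite matrix with a second-moment matrix bounded by `τ I`. -/
lemma sum_mul_le_trace {C M : Matrix m m ℝ} {τ : ℝ} (hM : M.PosSemidef)
    (hC : ∀ v : m → ℝ, v ⬝ᵥ (C *ᵥ v) ≤ τ * (v ⬝ᵥ v)) :
    ∑ b, ∑ c, C b c * M b c ≤ τ * M.trace := by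
  obtain ⟨B, rfl⟩ : ∃ B : Matrix m m ℝ, M = Bᴴ * B := by
    open scoped MatrixOrder in exact CStarAlgebra.nonneg_iff_eq_star_mul_self.mp hM.nonneg
  have e1 : ∑ b, ∑ c, C b c * (Bᴴ * B) b c = ∑ a, B a ⬝ᵥ (C *ᵥ B a) := by
    simp only [Matrix.mul_apply, conjTranspose_apply, star_trivial, dotProduct, mulVec,
      Finset.mul_sum]
    rw [Finset.sum_comm (s := Finset.univ (α := m)) (f := fun a b => ∑ c, B a b * (C b c * B a c))]
    refine Finset.sum_congr rfl fun b _ => ?_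
    rw [Finset.sum_comm]
    exact Finset.sum_congr rfl fun a _ => Finset.sum_congr rfl fun c _ => by ring
  have e2 : (Bᴴ * B).trace = ∑ a, B a ⬝ᵥ B a := by
    simp only [Matrix.trace, Matrix.diag, Matrix.mul_apply, conjTranspose_apply, star_trivial,
      dotProduct]
    rw [Finset.sum_comm]
  rw [e1, e2, Finset.mul_sum]
  exact Finset.sum_le_sum fun a _ => hC (B a)

variable {Ω : Type*} [MeasurableSpace Ω] {μ : Measure Ω} [IsProbabilityMeasure μ]

omit [DecidableEq m] in
lemma integrable_comp_of_bounded [Fintype ι] {z : ι → Ω → m → ℝ} (hz : ∀ i, Measurable (z i))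
    {R : ℝ} (hb : ∀ i ω, z i ω ⬝ᵥ z i ω ≤ R) {f : (ι → m → ℝ) → ℝ} (hf : Continuous f) :
    Integrable (fun ω => f fun i => z i ω) μ := by
  have hR : ∀ ω, (fun i => z i ω) ∈ Metric.closedBall (0 : ι → m → ℝ) √R := by
    intro ω
    rw [mem_closedBall_zero_iff, pi_norm_le_iff_of_nonneg (Real.sqrt_nonneg _)]
    intro i
    rw [pi_norm_le_iff_of_nonneg (Real.sqrt_nonneg _)]
    intro b
    rw [Real.norm_eq_abs]
    refine Real.abs_le_sqrt (le_trans ?_ (hb i ω))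
    rw [sq]
    exact Finset.single_le_sum (f := fun b => z i ω b * z i ω b)
      (fun b _ => mul_self_nonneg _) (Finset.mem_univ b)
  obtain ⟨C, hC⟩ := (isCompact_closedBall (0 : ι → m → ℝ) √R).exists_bound_of_continuousOn
    hf.continuousOn
  exact Integrable.of_bound (hf.measurable.comp (measurable_pi_lambda _ hz)).aestronglyMeasurable C
    (Filter.Eventually.of_forall fun ω => hC _ (hR ω))

omit [IsProbabilityMeasure μ] in
/-- A new vector is independent of the matrix built from the earlier ones. -/
lemma indepFun_entry_pow {z : ι → Ω → m → ℝ} (hz : ∀ i, Measurable (z i))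
    (hind : iIndepFun z μ) (u : ℝ) {s : Finset ι} {a : ι} (ha : a ∉ s) (N : ℕ) (b c : m) :
    IndepFun (fun ω => z a ω b * z a ω c)
      (fun ω => (shiftedGram u s (fun i => z i ω) ^ N) b c) μ := by
  classical
  have h : IndepFun (fun ω (i : s) => z i ω) (z a) μ :=
    (hind.indepFun_finset s {a} (by simpa using ha) hz).comp (φ := id)
      (ψ := fun Y : ({a} : Finset ι) → m → ℝ => Y ⟨a, Finset.mem_singleton_self a⟩)
      measurable_id (measurable_pi_apply _)
  have hφ : Measurable fun Y : s → m → ℝ =>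
      (shiftedGram u (Finset.univ : Finset s) Y ^ N) b c :=
    ((continuous_shiftedGram_pow u Finset.univ N).matrix_elem b c).measurable
  have hψ : Measurable fun y : m → ℝ => y b * y c :=
    (measurable_pi_apply b).mul (measurable_pi_apply c)
  have h2 := (h.comp hφ hψ).symm
  have e : (fun Y : s → m → ℝ => (shiftedGram u (Finset.univ : Finset s) Y ^ N) b c) ∘
      (fun ω (i : s) => z i ω) = fun ω => (shiftedGram u s (fun i => z i ω) ^ N) b c := by
    funext ω
    simp only [Function.comp]
    rw [shiftedGram_coe_sort u s (fun i => z i ω)]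
  rw [e] at h2
  exact h2

/-- The expectation over a new vector of its quadratic form: by independence, only its second-moment
matrix enters. -/
lemma integral_quadForm_le [Fintype ι] {z : ι → Ω → m → ℝ} (hz : ∀ i, Measurable (z i))
    (hind : iIndepFun z μ) {R : ℝ} (hb : ∀ i ω, z i ω ⬝ᵥ z i ω ≤ R) {τ : ℝ}
    (hτ : ∀ i (v : m → ℝ), ∫ ω, (v ⬝ᵥ z i ω) ^ 2 ∂μ ≤ τ * (v ⬝ᵥ v))
    {u : ℝ} (hu : 0 ≤ u) {s : Finset ι} {a : ι} (ha : a ∉ s) (N : ℕ) :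
    ∫ ω, z a ω ⬝ᵥ (shiftedGram u s (fun i => z i ω) ^ N *ᵥ z a ω) ∂μ
      ≤ τ * ∫ ω, (shiftedGram u s (fun i => z i ω) ^ N).trace ∂μ := by
  classical
  set M : Ω → Matrix m m ℝ := fun ω => shiftedGram u s (fun i => z i ω) ^ N with hM
  have cM : ∀ b c, Continuous fun Y : ι → m → ℝ => (shiftedGram u s Y ^ N) b c := fun b c =>
    (continuous_shiftedGram_pow u s N).matrix_elem b c
  have iM : ∀ b c, Integrable (fun ω => M ω b c) μ := fun b c =>
    integrable_comp_of_bounded hz hb (cM b c)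
  have izz : ∀ b c, Integrable (fun ω => z a ω b * z a ω c) μ := fun b c =>
    integrable_comp_of_bounded hz hb (f := fun Y => Y a b * Y a c)
      ((continuous_apply_apply a b).mul (continuous_apply_apply a c))
  have izM : ∀ b c, Integrable (fun ω => z a ω b * z a ω c * M ω b c) μ := fun b c =>
    integrable_comp_of_bounded hz hb (f := fun Y => Y a b * Y a c * (shiftedGram u s Y ^ N) b c)
      (((continuous_apply_apply a b).mul (continuous_apply_apply a c)).mul (cM b c))
  set C : Matrix m m ℝ := Matrix.of fun b c => ∫ ω, z a ω b * z a ω c ∂μ with hC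
  have hind2 : ∀ b c, ∫ ω, z a ω b * z a ω c * M ω b c ∂μ = C b c * ∫ ω, M ω b c ∂μ := by
    intro b c
    have h' := indepFun_entry_pow hz hind u ha N b c
    exact h'.integral_fun_mul_eq_mul_integral (izz b c).aestronglyMeasurable
      (iM b c).aestronglyMeasurable
  have hquad : ∀ (v : m → ℝ) (B : Matrix m m ℝ), v ⬝ᵥ (B *ᵥ v) = ∑ b, ∑ c, v b * v c * B b c := by
    intro v B
    simp only [dotProduct, mulVec, Finset.mul_sum]
    exact Finset.sum_congr rfl fun b _ => Finset.sum_congr rfl fun c _ => by ring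
  have hCq : ∀ v : m → ℝ, v ⬝ᵥ (C *ᵥ v) ≤ τ * (v ⬝ᵥ v) := by
    intro v
    refine le_trans (le_of_eq ?_) (hτ a v)
    have e : ∀ ω, (v ⬝ᵥ z a ω) ^ 2 = ∑ b, ∑ c, v b * v c * (z a ω b * z a ω c) := by
      intro ω
      rw [sq, dotProduct, Finset.sum_mul_sum]
      exact Finset.sum_congr rfl fun b _ => Finset.sum_congr rfl fun c _ => by ring
    simp only [e]
    rw [hquad, integral_finsetSum _ fun b _ => integrable_finsetSum _ fun c _ =>
      (izz b c).const_mul _]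
    refine Finset.sum_congr rfl fun b _ => ?_
    rw [integral_finsetSum _ fun c _ => (izz b c).const_mul _]
    exact Finset.sum_congr rfl fun c _ => by rw [integral_const_mul]; rfl
  have hpsd : ∀ ω, (M ω).PosSemidef := fun ω =>
    (PosSemidef.of_dotProduct_mulVec_nonneg (isHermitian_shiftedGram _ _ _) fun v => by
      simpa using (mul_nonneg hu (by simpa using dotProduct_star_self_nonneg v)).trans
        (le_quadForm_shiftedGram u s (fun i => z i ω) v)).pow N
  calc ∫ ω, z a ω ⬝ᵥ (M ω *ᵥ z a ω) ∂μ
      = ∑ b, ∑ c, C b c * ∫ ω, M ω b c ∂μ := by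
        simp only [hquad]
        rw [integral_finsetSum _ fun b _ => integrable_finsetSum _ fun c _ => izM b c]
        refine Finset.sum_congr rfl fun b _ => ?_
        rw [integral_finsetSum _ fun c _ => izM b c]
        exact Finset.sum_congr rfl fun c _ => hind2 b c
    _ = ∫ ω, ∑ b, ∑ c, C b c * M ω b c ∂μ := by
        symm
        refine (integral_finsetSum _ fun b _ => integrable_finsetSum _ fun c _ =>
          (iM b c).const_mul _).trans (Finset.sum_congr rfl fun b _ => ?_)
        exact (integral_finsetSum _ fun c _ => (iM b c).const_mul _).trans
          (Finset.sum_congr rfl fun c _ => integral_const_mul _ _)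
    _ ≤ ∫ ω, τ * (M ω).trace ∂μ := by
        refine integral_mono (integrable_finsetSum _ fun b _ => integrable_finsetSum _ fun c _ =>
          (iM b c).const_mul _) ((integrable_finsetSum _ fun b _ => iM b b).const_mul τ)
          fun ω => sum_mul_le_trace (hpsd ω) hCq
    _ = _ := integral_const_mul _ _

/-- The trace moment grows by at most a constant factor with each independent summand. -/
lemma integral_trace_pow_le [Fintype ι] {z : ι → Ω → m → ℝ} (hz : ∀ i, Measurable (z i))
    (hind : iIndepFun z μ) {u ρ τ : ℝ} (hu : 0 < u) (hρ : 0 ≤ ρ) (hτ0 : 0 ≤ τ)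
    (hb : ∀ i ω, z i ω ⬝ᵥ z i ω ≤ ρ * u)
    (hτ : ∀ i (v : m → ℝ), ∫ ω, (v ⬝ᵥ z i ω) ^ 2 ∂μ ≤ τ * (v ⬝ᵥ v)) (N : ℕ) (s : Finset ι) :
    ∫ ω, (shiftedGram u s (fun i => z i ω) ^ (N + 1)).trace ∂μ
      ≤ Fintype.card m * u ^ (N + 1) * (1 + (N + 1) * (1 + ρ) ^ N * (τ / u)) ^ s.card := by
  classical
  have itr : ∀ (s : Finset ι) (k : ℕ),
      Integrable (fun ω => (shiftedGram u s (fun i => z i ω) ^ k).trace) μ := fun s k =>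
    integrable_comp_of_bounded hz hb (f := fun Y => (shiftedGram u s Y ^ k).trace)
      (continuous_shiftedGram_pow u s k).matrix_trace
  induction s using Finset.induction_on with
  | empty =>
    simp [shiftedGram, smul_pow, mul_comm]
  | insert a s ha ih =>
    set c := (N + 1) * (1 + ρ) ^ N with hc
    have hc0 : 0 ≤ c := by positivity
    set I := ∫ ω, (shiftedGram u s (fun i => z i ω) ^ (N + 1)).trace ∂μ with hI
    have iq : Integrable
        (fun ω => z a ω ⬝ᵥ (shiftedGram u s (fun i => z i ω) ^ N *ᵥ z a ω)) μ :=
      integrable_comp_of_bounded hz hb (f := fun Y => Y a ⬝ᵥ (shiftedGram u s Y ^ N *ᵥ Y a))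
        (Continuous.dotProduct (continuous_apply a)
          (Continuous.matrix_mulVec (continuous_shiftedGram_pow u s N) (continuous_apply a)))
    have h1 : ∫ ω, (shiftedGram u (insert a s) (fun i => z i ω) ^ (N + 1)).trace ∂μ
        ≤ I + c * ∫ ω, z a ω ⬝ᵥ (shiftedGram u s (fun i => z i ω) ^ N *ᵥ z a ω) ∂μ := by
      rw [hI, ← integral_const_mul, ← integral_add (itr s _) (iq.const_mul c)]
      refine integral_mono (itr _ _) ((itr s _).add (iq.const_mul c)) fun ω => ?_
      simp only [shiftedGram_insert u ha]
      exact trace_pow_add_vecMulVec_le (isHermitian_shiftedGram _ _ _) hu.le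
        (le_quadForm_shiftedGram u s _) hρ (hb a ω) N
    have h2 := integral_quadForm_le hz hind hb hτ hu.le ha N
    have h3 : ∫ ω, (shiftedGram u s (fun i => z i ω) ^ N).trace ∂μ ≤ I / u := by
      rw [le_div_iff₀' hu, hI, ← integral_const_mul]
      exact integral_mono ((itr s N).const_mul u) (itr s (N + 1)) fun ω =>
        mul_trace_pow_le (isHermitian_shiftedGram _ _ _) hu.le (le_quadForm_shiftedGram u s _) N
    have h4 := h2.trans (mul_le_mul_of_nonneg_left h3 hτ0)
    have h5 := h1.trans (add_le_add_right (mul_le_mul_of_nonneg_left h4 hc0) I)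
    have e : I + c * (τ * (I / u)) = I * (1 + c * (τ / u)) := by ring
    rw [e] at h5
    refine h5.trans ?_
    rw [Finset.card_insert_of_notMem ha, pow_succ (1 + _), ← mul_assoc]
    exact mul_le_mul_of_nonneg_right ih (by positivity)

/-- Chernoff-type bound: outside a small event the Gram matrix of independent bounded vectors is
at most `(T - u) I`. -/
lemma measureReal_trace_pow_ge_le [Fintype ι] {z : ι → Ω → m → ℝ} (hz : ∀ i, Measurable (z i))
    (hind : iIndepFun z μ) {u ρ τ T : ℝ} (hu : 0 < u) (hρ : 0 ≤ ρ) (hτ0 : 0 ≤ τ) (hT : 0 < T)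
    (hb : ∀ i ω, z i ω ⬝ᵥ z i ω ≤ ρ * u)
    (hτ : ∀ i (v : m → ℝ), ∫ ω, (v ⬝ᵥ z i ω) ^ 2 ∂μ ≤ τ * (v ⬝ᵥ v)) (N : ℕ) :
    ∃ A : Set Ω, MeasurableSet A ∧
      μ.real A ≤ Fintype.card m * (u / T) ^ (N + 1)
        * (1 + (N + 1) * (1 + ρ) ^ N * (τ / u)) ^ Fintype.card ι ∧
      ∀ ω ∉ A, ∀ v : m → ℝ, ∑ i, (v ⬝ᵥ z i ω) ^ 2 ≤ (T - u) * (v ⬝ᵥ v) := by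
  set f : Ω → ℝ := fun ω => (shiftedGram u Finset.univ (fun i => z i ω) ^ (N + 1)).trace with hf
  have hcont := (continuous_shiftedGram_pow (m := m) u (Finset.univ : Finset ι) (N + 1)).matrix_trace
  have hfm : Measurable f := hcont.measurable.comp (measurable_pi_lambda _ hz)
  have hfi : Integrable f μ := integrable_comp_of_bounded hz hb hcont
  refine ⟨{ω | T ^ (N + 1) ≤ f ω}, measurableSet_le measurable_const hfm, ?_, fun ω hω v => ?_⟩
  · have h1 := mul_meas_ge_le_integral_of_nonneg (μ := μ) (f := f)
      (Filter.Eventually.of_forall fun ω => trace_pow_nonneg (isHermitian_shiftedGram _ _ _) hu.le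
        (le_quadForm_shiftedGram u _ _) _) hfi (T ^ (N + 1))
    have h2 := integral_trace_pow_le hz hind hu hρ hτ0 hb hτ N Finset.univ
    have h3 := h1.trans h2
    rw [Finset.card_univ] at h3
    have hT' : 0 < T ^ (N + 1) := by positivity
    rw [← le_div_iff₀' hT'] at h3
    refine h3.trans (le_of_eq ?_)
    rw [div_pow]; ring
  · have h := quadForm_le_of_trace_pow_lt (isHermitian_shiftedGram u Finset.univ fun i => z i ω)
      (fun v => (mul_nonneg hu.le (by simpa using dotProduct_star_self_nonneg v)).trans
        (le_quadForm_shiftedGram u _ _ v)) hT.le (p := N + 1) (by simpa using hω) v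
    rw [quadForm_shiftedGram] at h
    linarith

end MatrixConcentration

/-! ### Robust mean estimation on a sample with a stable subset -/

section Deterministic

open Matrix

lemma lambdaMax_le_iff {d : ℕ} (hd : 0 < d) {A : Matrix (Fin d) (Fin d) ℝ} (hA : A.IsHermitian)
    {C : ℝ} : lambdaMax A ≤ C ↔ ∀ v, v ⬝ᵥ (A *ᵥ v) ≤ C * (v ⬝ᵥ v) := by
  obtain ⟨l, -, hz, hl, hspec⟩ := exists_eigenvalue_moments hA
  have hne : Nonempty (Fin d) := ⟨⟨0, hd⟩⟩
  rw [lambdaMax, hspec]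
  constructor
  · intro h v
    obtain ⟨w, hw, hk⟩ := hz v
    have e0 : v ⬝ᵥ v = ∑ i, w i := by simpa using hk 0
    have e1 : v ⬝ᵥ (A *ᵥ v) = ∑ i, w i * l i := by simpa using hk 1
    rw [e0, e1, Finset.mul_sum]
    refine Finset.sum_le_sum fun i _ => ?_
    rw [mul_comm C]
    exact mul_le_mul_of_nonneg_left
      ((le_csSup (Set.finite_range l).bddAbove (Set.mem_range_self i)).trans h) (hw i)
  · intro h
    refine csSup_le (Set.range_nonempty l) ?_
    rintro _ ⟨i, rfl⟩
    obtain ⟨v, hv, hv'⟩ := hl i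
    simpa [hv, hv'] using h v

variable {n d : ℕ}

lemma lambdaMax_scatter_le_iff (hd : 0 < d) (y : Fin n → EuclideanSpace ℝ (Fin d)) (h : Fin n → ℝ)
    (x : EuclideanSpace ℝ (Fin d)) {C : ℝ} :
    lambdaMax (scatter y h x) ≤ C ↔
      ∀ v : EuclideanSpace ℝ (Fin d), ∑ i, (1 - h i) * inner ℝ v (y i - x) ^ 2 ≤ C * ‖v‖ ^ 2 := by
  have hherm : (scatter y h x).IsHermitian := by
    ext b c
    simp [scatter, Matrix.sum_apply, vecMulVec_apply, mul_comm]
  have e : ∀ v : EuclideanSpace ℝ (Fin d),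
      WithLp.ofLp v ⬝ᵥ (scatter y h x *ᵥ WithLp.ofLp v)
        = ∑ i, (1 - h i) * inner ℝ v (y i - x) ^ 2 := by
    intro v
    rw [scatter, sum_mulVec, dotProduct_sum]
    refine Finset.sum_congr rfl fun i _ => ?_
    rw [smul_mulVec, vecMulVec_mulVec, dotProduct_smul, EuclideanSpace.inner_eq_star_dotProduct]
    simp [dotProduct_comm, sq]
  have e' : ∀ v : EuclideanSpace ℝ (Fin d),
      WithLp.ofLp v ⬝ᵥ WithLp.ofLp v = ‖v‖ ^ 2 := by
    intro v
    rw [← real_inner_self_eq_norm_sq, EuclideanSpace.inner_eq_star_dotProduct]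
    simp
  rw [lambdaMax_le_iff hd hherm]
  constructor
  · intro H v
    rw [← e, ← e']
    exact H _
  · intro H v
    have := H (WithLp.toLp 2 v)
    rwa [← e, ← e'] at this

lemma norm_sum_sq_le {ι E : Type*} [NormedAddCommGroup E] [InnerProductSpace ℝ E] (s : Finset ι)
    (w : ι → E) {C : ℝ} (hC : 0 ≤ C) (h : ∀ v, ∑ i ∈ s, inner ℝ v (w i) ^ 2 ≤ C * ‖v‖ ^ 2) :
    ‖∑ i ∈ s, w i‖ ^ 2 ≤ s.card * C := by
  set v := ∑ i ∈ s, w i with hv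
  have h1 : ‖v‖ ^ 2 = ∑ i ∈ s, inner ℝ v (w i) := by
    rw [← real_inner_self_eq_norm_sq]; conv_lhs => rw [hv, inner_sum]
  have h2 : (‖v‖ ^ 2) ^ 2 ≤ s.card * (C * ‖v‖ ^ 2) := by
    conv_lhs => rw [h1]
    exact sq_sum_le_card_mul_sum_sq.trans (mul_le_mul_of_nonneg_left (h v) (by positivity))
  rcases (sq_nonneg ‖v‖).eq_or_lt with h0 | h0
  · rw [← h0]; positivity
  · nlinarith

/-- What the clean sample has to satisfy for the robust estimate to work: all but few points,
those in `S`, have a second-moment matrix about `xstar`, normalized by `n`, that is at most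
`(3/2) σ² I`, and their deviations from `xstar` nearly cancel. -/
structure IsStableSubset (α σ : ℝ) (xstar : EuclideanSpace ℝ (Fin d))
    (ytilde : Fin n → EuclideanSpace ℝ (Fin d)) (S : Finset (Fin n)) : Prop where
  card_compl_le : (Sᶜ.card : ℝ) ≤ α * n / 160
  sum_inner_sq_le : ∀ v : EuclideanSpace ℝ (Fin d),
    ∑ i ∈ S, inner ℝ v (ytilde i - xstar) ^ 2 ≤ 3 / 2 * n * σ ^ 2 * ‖v‖ ^ 2
  norm_sum_le : ‖∑ i ∈ S, (ytilde i - xstar)‖ ≤ 0.7 * n * σ * √α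

variable {α σ c₁ : ℝ} {xstar : EuclideanSpace ℝ (Fin d)}
  {ytilde y : Fin n → EuclideanSpace ℝ (Fin d)} {S : Finset (Fin n)}

lemma card_ne_le (hcor : IsCorruption α ytilde y) :
    ((Finset.univ.filter fun i => y i ≠ ytilde i).card : ℝ) ≤ α * n := by
  have h : {i | y i ≠ ytilde i} = ((Finset.univ.filter fun i => y i ≠ ytilde i : Finset (Fin n)) :
      Set (Fin n)) := by ext; simp
  have := hcor
  rw [IsCorruption, h, Set.ncard_coe_finset] at this
  exact this

/-- Removing the corrupted points and the points outside `S` is feasible, so a minimizer removes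
no more points than that. -/
lemma IsStableSubset.hammingNorm_le (hS : IsStableSubset α σ xstar ytilde S) (hd : 0 < d)
    (hc₁ : 3 / 2 ≤ c₁ ^ 2) (hcor : IsCorruption α ytilde y) {h : Fin n → ℝ}
    {x : EuclideanSpace ℝ (Fin d)} (hopt : IsGlobalOpt c₁ σ y h x) :
    (hammingNorm h : ℝ) ≤ 161 / 160 * α * n := by
  classical
  set G := S.filter fun i => y i = ytilde i with hG
  set h' : Fin n → ℝ := fun i => if i ∈ G then 0 else 1 with hh'
  have hfeas : IsFeasible c₁ σ y h' xstar := by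
    refine ⟨fun i => by simp only [hh']; split_ifs <;> norm_num, ?_⟩
    rw [lambdaMax_scatter_le_iff hd]
    intro v
    have e : ∑ i, (1 - h' i) * inner ℝ v (y i - xstar) ^ 2
        = ∑ i ∈ G, inner ℝ v (ytilde i - xstar) ^ 2 := by
      rw [← Finset.sum_subset (Finset.subset_univ G)]
      · refine Finset.sum_congr rfl fun i hi => ?_
        have : y i = ytilde i := (Finset.mem_filter.1 hi).2
        simp [hh', hi, this]
      · intro i _ hi
        simp [hh', hi]
    rw [e]
    refine (Finset.sum_le_sum_of_subset_of_nonneg (Finset.filter_subset _ _)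
      fun i _ _ => sq_nonneg _).trans ((hS.sum_inner_sq_le v).trans ?_)
    gcongr
  have h1 : (hammingNorm h : ℝ) ≤ hammingNorm h' := by exact_mod_cast hopt.2 h' xstar hfeas
  refine h1.trans ?_
  have h2 : hammingNorm h' ≤ (Finset.univ.filter fun i => y i ≠ ytilde i).card + Sᶜ.card := by
    refine le_trans (Finset.card_le_card ?_) (Finset.card_union_le _ _)
    intro i hi
    have hi' : i ∉ G := by
      intro hiG
      simp [hh', hiG] at hi
    simp only [hG, Finset.mem_filter, not_and] at hi'
    by_cases hiS : i ∈ S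
    · simp [hi' hiS]
    · simp [hiS]
  have h3 : (hammingNorm h' : ℝ)
      ≤ (Finset.univ.filter fun i => y i ≠ ytilde i).card + Sᶜ.card := by exact_mod_cast h2
  have := card_ne_le hcor
  have := hS.card_compl_le
  linarith

/-- The error of any feasible solution that removes few points: it is compared with the uncorrupted
points of `S` on their common part, which holds more than a third of the sample, and the sums over
the few points outside it are controlled by the second-moment bounds. -/
lemma IsStableSubset.norm_inlierMean_sub_le (hS : IsStableSubset α σ xstar ytilde S) (hd : 0 < d)
    (hn : 0 < n) (hσ : 0 ≤ σ) (hα : 0 < α) (hα' : α ≤ 0.33) (hc₁ : 0 ≤ c₁)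
    (hcor : IsCorruption α ytilde y) {h : Fin n → ℝ} {x : EuclideanSpace ℝ (Fin d)}
    (hfeas : IsFeasible c₁ σ y h x) (hbin : IsBinary h) (hx : x = inlierMean y h)
    (hcard : (hammingNorm h : ℝ) ≤ 161 / 160 * α * n) :
    ‖x - xstar‖ ≤ (7.5 + 3.1 * c₁) * σ * √α := by
  classical
  have hn' : (0 : ℝ) < n := by exact_mod_cast hn
  have hαn : 0 < α * n := by positivity
  set K := Finset.univ.filter fun i => h i = 0 with hK
  set B := Finset.univ.filter fun i => y i ≠ ytilde i with hB
  set D := K ∩ (S.filter fun i => y i = ytilde i) with hD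
  have hB' : (B.card : ℝ) ≤ α * n := card_ne_le hcor
  have hKc : (Kᶜ.card : ℝ) ≤ 161 / 160 * α * n := by
    refine le_trans (le_of_eq ?_) hcard
    congr 1
    rw [hammingNorm]
    congr 1
    ext i; simp [hK]
  have hSc := hS.card_compl_le
  have hDS : D ⊆ S := Finset.inter_subset_right.trans (Finset.filter_subset _ _)
  have hDK : D ⊆ K := Finset.inter_subset_left
  have hT1 : ((S \ D).card : ℝ) ≤ 2.00625 * (α * n) := by
    have : (S \ D).card ≤ B.card + Kᶜ.card := by
      refine le_trans (Finset.card_le_card fun i hi => ?_) (Finset.card_union_le _ _)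
      simp only [hD, hB, Finset.mem_sdiff, Finset.mem_inter, Finset.mem_filter, Finset.mem_union,
        Finset.mem_compl, Finset.mem_univ] at hi ⊢
      tauto
    have : ((S \ D).card : ℝ) ≤ B.card + Kᶜ.card := by exact_mod_cast this
    linarith
  have hT2 : ((K \ D).card : ℝ) ≤ 1.00625 * (α * n) := by
    have : (K \ D).card ≤ B.card + Sᶜ.card := by
      refine le_trans (Finset.card_le_card fun i hi => ?_) (Finset.card_union_le _ _)
      simp only [hD, hB, Finset.mem_sdiff, Finset.mem_inter, Finset.mem_filter, Finset.mem_union,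
        Finset.mem_compl, Finset.mem_univ] at hi ⊢
      tauto
    have : ((K \ D).card : ℝ) ≤ B.card + Sᶜ.card := by exact_mod_cast this
    linarith
  have hKcard : (K.card : ℝ) + Kᶜ.card = n := by
    have := Finset.card_add_card_compl K
    rw [Fintype.card_fin] at this
    exact_mod_cast this
  -- `1 - 2.0125 * 0.33 = 0.335875`
  have hDcard : 0.335875 * n ≤ (D.card : ℝ) := by
    have h1 := Finset.card_sdiff_add_card_eq_card hDK
    have h2 : ((K \ D).card : ℝ) + D.card = K.card := by exact_mod_cast h1
    nlinarith
  -- the deviations of the kept points from their average cancel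
  have hsumK : ∑ i ∈ K, (y i - x) = 0 := by
    have hw : ∀ f : Fin n → EuclideanSpace ℝ (Fin d), ∑ i, (1 - h i) • f i = ∑ i ∈ K, f i := by
      intro f
      rw [← Finset.sum_subset (Finset.subset_univ K)]
      · refine Finset.sum_congr rfl fun i hi => ?_
        simp [(Finset.mem_filter.1 hi).2]
      · intro i _ hi
        have : h i = 1 := (hbin i).resolve_left (by simpa [hK] using hi)
        simp [this]
    have hw1 : ∑ i, (1 - h i) = K.card := by
      rw [← Finset.sum_subset (Finset.subset_univ K), Finset.card_eq_sum_ones, Nat.cast_sum]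
      · refine Finset.sum_congr rfl fun i hi => ?_
        simp [(Finset.mem_filter.1 hi).2]
      · intro i _ hi
        have : h i = 1 := (hbin i).resolve_left (by simpa [hK] using hi)
        simp [this]
    have hKpos : (K.card : ℝ) ≠ 0 := by
      have : (D.card : ℝ) ≤ K.card := by exact_mod_cast Finset.card_le_card hDK
      have : 0 < 0.335875 * (n : ℝ) := by positivity
      linarith
    rw [Finset.sum_sub_distrib, Finset.sum_const, hx, inlierMean, Finset.centerMass, hw, hw1,
      ← Nat.cast_smul_eq_nsmul ℝ, smul_smul, mul_inv_cancel₀ hKpos, one_smul, sub_self]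
  have hdecomp : (D.card : ℝ) • (x - xstar) = ∑ i ∈ S, (ytilde i - xstar)
      - ∑ i ∈ S \ D, (ytilde i - xstar) + ∑ i ∈ K \ D, (y i - x) := by
    have h1 := Finset.sum_sdiff hDS (f := fun i => ytilde i - xstar)
    have h2 := Finset.sum_sdiff hDK (f := fun i => y i - x)
    rw [hsumK] at h2
    have h3 : ∑ i ∈ D, (ytilde i - xstar) = ∑ i ∈ D, (y i - x) + (D.card : ℝ) • (x - xstar) := by
      rw [Nat.cast_smul_eq_nsmul, ← Finset.sum_const, ← Finset.sum_add_distrib]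
      refine Finset.sum_congr rfl fun i hi => ?_
      have : y i = ytilde i := (Finset.mem_filter.1 (Finset.mem_inter.1 hi).2).2
      rw [this]; abel
    rw [← h1, h3, eq_neg_of_add_eq_zero_left h2]
    abel
  set q := n * σ * √α with hq
  have hq0 : 0 ≤ q := by positivity
  have hq2 : q ^ 2 = α * n * (n * σ ^ 2) := by
    rw [hq, mul_pow, mul_pow, Real.sq_sqrt hα.le]; ring
  have hnσ : 0 ≤ n * σ ^ 2 := by positivity
  -- `1.735 ^ 2 ≥ 2.00625 * 1.5` and `1.0032 ^ 2 ≥ 1.00625`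
  have hN1 : ‖∑ i ∈ S \ D, (ytilde i - xstar)‖ ≤ 1.735 * q := by
    have h1 := norm_sum_sq_le (S \ D) (fun i => ytilde i - xstar) (C := 3 / 2 * n * σ ^ 2)
      (by positivity) fun v => (Finset.sum_le_sum_of_subset_of_nonneg Finset.sdiff_subset
        fun i _ _ => sq_nonneg _).trans (hS.sum_inner_sq_le v)
    refine (pow_le_pow_iff_left₀ (norm_nonneg _) (by positivity) two_ne_zero).1 ?_
    rw [mul_pow, hq2]
    have := mul_le_mul_of_nonneg_right hT1 hnσ
    have : 0 ≤ α * n * (n * σ ^ 2) := by positivity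
    nlinarith
  have hN2 : ‖∑ i ∈ K \ D, (y i - x)‖ ≤ 1.0032 * c₁ * q := by
    have h1 := norm_sum_sq_le (K \ D) (fun i => y i - x) (C := c₁ ^ 2 * n * σ ^ 2)
      (by positivity) fun v => by
        refine le_trans ?_ ((lambdaMax_scatter_le_iff hd y h x).1 hfeas.2 v)
        refine le_trans (le_of_eq (Finset.sum_congr rfl fun i hi => ?_))
          (Finset.sum_le_sum_of_subset_of_nonneg (Finset.subset_univ (K \ D)) fun i _ _ =>
            mul_nonneg (sub_nonneg.2 (hfeas.1 i).2) (sq_nonneg _))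
        have : h i = 0 := (Finset.mem_filter.1 (Finset.mem_sdiff.1 hi).1).2
        simp [this]
    refine (pow_le_pow_iff_left₀ (norm_nonneg _) (by positivity) two_ne_zero).1 ?_
    rw [mul_pow, mul_pow, hq2]
    have := mul_le_mul_of_nonneg_right hT2 (mul_nonneg (sq_nonneg c₁) hnσ)
    have : 0 ≤ c₁ ^ 2 * (α * n * (n * σ ^ 2)) := by positivity
    nlinarith
  have hN0 : ‖∑ i ∈ S, (ytilde i - xstar)‖ ≤ 0.7 * q := by
    have := hS.norm_sum_le
    rw [hq]; linarith
  have hfin : (D.card : ℝ) * ‖x - xstar‖ ≤ (2.435 + 1.0032 * c₁) * q := by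
    have h1 := norm_add_le (∑ i ∈ S, (ytilde i - xstar) - ∑ i ∈ S \ D, (ytilde i - xstar))
      (∑ i ∈ K \ D, (y i - x))
    have h2 := norm_sub_le (∑ i ∈ S, (ytilde i - xstar)) (∑ i ∈ S \ D, (ytilde i - xstar))
    rw [← hdecomp, norm_smul, Real.norm_natCast] at h1
    linarith
  have hlow := mul_le_mul_of_nonneg_right hDcard (norm_nonneg (x - xstar))
  have hσα : 0 ≤ σ * √α := by positivity
  have h4 : n * (0.335875 * ‖x - xstar‖) ≤ n * ((2.435 + 1.0032 * c₁) * (σ * √α)) := by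
    rw [hq] at hfin; linarith
  have h5 := le_of_mul_le_mul_left h4 hn'
  have h6 : 0 ≤ c₁ * (σ * √α) := by positivity
  nlinarith

end Deterministic

/-! ### Truncating a distribution with bounded covariance -/

section Truncation

variable {d : ℕ} {P : Measure (EuclideanSpace ℝ (Fin d))} [IsProbabilityMeasure P]
  {xstar : EuclideanSpace ℝ (Fin d)} {σ : ℝ}

lemma integral_inner_sub_sq_le (hP : MemLp (fun z : EuclideanSpace ℝ (Fin d) => z) 2 P)
    (hmean : ∫ z, z ∂P = xstar)
    (hcov : (σ ^ 2 • (1 : Matrix (Fin d) (Fin d) ℝ) - covMatrix P).PosSemidef)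
    (v : EuclideanSpace ℝ (Fin d)) : ∫ z, inner ℝ v (z - xstar) ^ 2 ∂P ≤ σ ^ 2 * ‖v‖ ^ 2 := by
  have hc : ∀ i, MemLp (fun z : EuclideanSpace ℝ (Fin d) => z i - xstar i) 2 P := fun i =>
    ((EuclideanSpace.proj (𝕜 := ℝ) i).comp_memLp' hP).sub (memLp_const _)
  have hmi : ∀ i, ∫ z, (fun z : EuclideanSpace ℝ (Fin d) => z i) z ∂P = xstar i := by
    intro i
    rw [← hmean]
    exact (EuclideanSpace.proj (𝕜 := ℝ) i).integral_comp_comm (hP.integrable one_le_two)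
  have hcovij : ∀ i j, covMatrix P i j = ∫ z, (z i - xstar i) * (z j - xstar j) ∂P := by
    intro i j
    simp only [covMatrix, Matrix.of_apply, covariance, hmi]
  have hint : ∀ i j, Integrable
      (fun z : EuclideanSpace ℝ (Fin d) => (z i - xstar i) * (z j - xstar j)) P := fun i j =>
    (hc i).integrable_mul (hc j)
  have e1 : ∫ z, inner ℝ v (z - xstar) ^ 2 ∂P = ∑ i, ∑ j, v i * v j * covMatrix P i j := by
    have e : ∀ z : EuclideanSpace ℝ (Fin d), inner ℝ v (z - xstar) ^ 2
        = ∑ i, ∑ j, v i * v j * ((z i - xstar i) * (z j - xstar j)) := by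
      intro z
      rw [PiLp.inner_apply, sq, Finset.sum_mul_sum]
      refine Finset.sum_congr rfl fun i _ => Finset.sum_congr rfl fun j _ => ?_
      simp
      ring
    simp only [e]
    rw [integral_finsetSum _ fun i _ => integrable_finsetSum _ fun j _ => (hint i j).const_mul _]
    refine Finset.sum_congr rfl fun i _ => ?_
    rw [integral_finsetSum _ fun j _ => (hint i j).const_mul _]
    exact Finset.sum_congr rfl fun j _ => by rw [integral_const_mul, hcovij]
  have h := hcov.dotProduct_mulVec_nonneg (WithLp.ofLp v)
  rw [Matrix.sub_mulVec, dotProduct_sub, Matrix.smul_mulVec, Matrix.one_mulVec,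
    dotProduct_smul] at h
  have e2 : star (WithLp.ofLp v) ⬝ᵥ WithLp.ofLp v = ‖v‖ ^ 2 := by
    rw [← real_inner_self_eq_norm_sq, EuclideanSpace.inner_eq_star_dotProduct, dotProduct_comm]
  have e3 : star (WithLp.ofLp v) ⬝ᵥ (Matrix.mulVec (covMatrix P) (WithLp.ofLp v))
      = ∑ i, ∑ j, v i * v j * covMatrix P i j := by
    simp only [dotProduct, Matrix.mulVec, star_trivial, Finset.mul_sum]
    exact Finset.sum_congr rfl fun i _ => Finset.sum_congr rfl fun j _ => by ring
  rw [e2, e3, ← e1, smul_eq_mul] at h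
  linarith

lemma integral_norm_sub_sq_le (hP : MemLp (fun z : EuclideanSpace ℝ (Fin d) => z) 2 P)
    (hV : ∀ v, ∫ z, inner ℝ v (z - xstar) ^ 2 ∂P ≤ σ ^ 2 * ‖v‖ ^ 2) :
    ∫ z, ‖z - xstar‖ ^ 2 ∂P ≤ d * σ ^ 2 := by
  have hc : ∀ i, Integrable (fun z : EuclideanSpace ℝ (Fin d) => (z i - xstar i) ^ 2) P := fun i =>
    (((EuclideanSpace.proj (𝕜 := ℝ) i).comp_memLp' hP).sub (memLp_const _)).integrable_sq
  have e : ∀ z : EuclideanSpace ℝ (Fin d), ‖z - xstar‖ ^ 2 = ∑ i, (z i - xstar i) ^ 2 := by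
    intro z
    rw [EuclideanSpace.norm_sq_eq]
    simp
  simp only [e]
  rw [integral_finsetSum _ fun i _ => hc i]
  calc ∑ i, ∫ z : EuclideanSpace ℝ (Fin d), (z i - xstar i) ^ 2 ∂P ≤ ∑ _i : Fin d, σ ^ 2 := by
        refine Finset.sum_le_sum fun i _ => ?_
        simpa [EuclideanSpace.inner_single_left] using hV (EuclideanSpace.single i 1)
    _ = d * σ ^ 2 := by simp

/-- The vector `w`, replaced by `0` if it is longer than `R`. -/
noncomputable def truncate (R : ℝ) (w : EuclideanSpace ℝ (Fin d)) : EuclideanSpace ℝ (Fin d) :=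
  open Classical in if ‖w‖ ≤ R then w else 0

lemma measurable_truncate (R : ℝ) : Measurable (truncate (d := d) R) :=
  Measurable.ite (measurableSet_le measurable_norm measurable_const) measurable_id measurable_const

lemma norm_truncate_le {R : ℝ} (hR : 0 ≤ R) (w : EuclideanSpace ℝ (Fin d)) :
    ‖truncate R w‖ ≤ R := by
  rw [truncate]; split_ifs with h
  · exact h
  · simpa using hR

lemma norm_truncate_le_norm (R : ℝ) (w : EuclideanSpace ℝ (Fin d)) : ‖truncate R w‖ ≤ ‖w‖ := by
  rw [truncate]; split_ifs
  · exact le_rfl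
  · simp

lemma inner_truncate_sq_le (R : ℝ) (v w : EuclideanSpace ℝ (Fin d)) :
    inner ℝ v (truncate R w) ^ 2 ≤ inner ℝ v w ^ 2 := by
  rw [truncate]; split_ifs
  · exact le_rfl
  · simpa using sq_nonneg _

lemma measurable_truncate_sub (R : ℝ) (xstar : EuclideanSpace ℝ (Fin d)) :
    Measurable fun z => truncate R (z - xstar) :=
  (measurable_truncate R).comp (measurable_id.sub_const _)

lemma integrable_truncate_sub {R : ℝ} (hR : 0 ≤ R) :
    Integrable (fun z => truncate R (z - xstar)) P :=
  Integrable.of_bound (measurable_truncate_sub R xstar).aestronglyMeasurable R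
    (Filter.Eventually.of_forall fun _ => norm_truncate_le hR _)

lemma measurableSet_lt_norm_sub (R : ℝ) (xstar : EuclideanSpace ℝ (Fin d)) :
    MeasurableSet {z | R < ‖z - xstar‖} :=
  measurableSet_lt measurable_const (measurable_id.sub_const _).norm

lemma integrable_norm_sub_sq (hP : MemLp (fun z : EuclideanSpace ℝ (Fin d) => z) 2 P) :
    Integrable (fun z => ‖z - xstar‖ ^ 2) P :=
  (hP.sub (memLp_const xstar)).norm.integrable_sq

lemma integrable_inner_sub_sq (hP : MemLp (fun z : EuclideanSpace ℝ (Fin d) => z) 2 P)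
    (v : EuclideanSpace ℝ (Fin d)) : Integrable (fun z => inner ℝ v (z - xstar) ^ 2) P :=
  ((hP.sub (memLp_const xstar)).const_inner v).integrable_sq

/-- Chebyshev's inequality for the Euclidean norm. -/
lemma sq_mul_measureReal_lt_norm_sub_le
    (hP : MemLp (fun z : EuclideanSpace ℝ (Fin d) => z) 2 P)
    (hV : ∀ v, ∫ z, inner ℝ v (z - xstar) ^ 2 ∂P ≤ σ ^ 2 * ‖v‖ ^ 2) {R : ℝ} (hR : 0 ≤ R) :
    R ^ 2 * P.real {z | R < ‖z - xstar‖} ≤ d * σ ^ 2 := by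
  refine le_trans ?_ ((mul_meas_ge_le_integral_of_nonneg
    (Filter.Eventually.of_forall fun z => sq_nonneg _) (integrable_norm_sub_sq hP) (R ^ 2)).trans
      (integral_norm_sub_sq_le hP hV))
  refine mul_le_mul_of_nonneg_left (measureReal_mono fun z hz => ?_) (sq_nonneg _)
  have hz' : R < ‖z - xstar‖ := hz
  exact pow_le_pow_left₀ hR hz'.le 2

/-- Truncation moves the mean by at most `σ` times the root of the truncated mass. -/
lemma norm_integral_truncate_sq_le (hP : MemLp (fun z : EuclideanSpace ℝ (Fin d) => z) 2 P)
    (hmean : ∫ z, z ∂P = xstar) (hσ : 0 < σ)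
    (hV : ∀ v, ∫ z, inner ℝ v (z - xstar) ^ 2 ∂P ≤ σ ^ 2 * ‖v‖ ^ 2) {R : ℝ} (hR : 0 ≤ R) :
    ‖∫ z, truncate R (z - xstar) ∂P‖ ^ 2 ≤ P.real {z | R < ‖z - xstar‖} * σ ^ 2 := by
  set b := ∫ z, truncate R (z - xstar) ∂P with hb
  set q := P.real {z | R < ‖z - xstar‖} with hq
  have hPi : Integrable (fun z : EuclideanSpace ℝ (Fin d) => z) P := hP.integrable one_le_two
  have hwi : Integrable (fun z => z - xstar) P := hPi.sub (integrable_const _)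
  have hti : Integrable (fun z => truncate R (z - xstar)) P := integrable_truncate_sub hR
  have hdi : Integrable (fun z => truncate R (z - xstar) - (z - xstar)) P := hti.sub hwi
  have hw0 : ∫ z, (z - xstar) ∂P = 0 := by
    rw [integral_sub hPi (integrable_const _), hmean]; simp
  have hbb : ‖b‖ ^ 2 = ∫ z, inner ℝ b (truncate R (z - xstar) - (z - xstar)) ∂P := by
    rw [integral_inner hdi, integral_sub hti hwi, hw0, sub_zero, ← hb,
      real_inner_self_eq_norm_sq]
  -- `a ≤ (a² / σ² + σ²) / 2`, used where the truncation acts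
  have hpt : ∀ z, inner ℝ b (truncate R (z - xstar) - (z - xstar))
      ≤ 1 / (2 * σ ^ 2) * inner ℝ b (z - xstar) ^ 2
        + σ ^ 2 / 2 * Set.indicator {z | R < ‖z - xstar‖} (fun _ => (1 : ℝ)) z := by
    intro z
    by_cases h : ‖z - xstar‖ ≤ R
    · have h' : z ∉ {z | R < ‖z - xstar‖} := by simpa using h
      rw [truncate, if_pos h, Set.indicator_of_notMem h']
      simp only [sub_self, inner_zero_right]
      positivity
    · have h' : z ∈ {z | R < ‖z - xstar‖} := by simpa using h
      rw [truncate, if_neg h, Set.indicator_of_mem h', zero_sub, inner_neg_right]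
      set a := inner ℝ b (z - xstar)
      have e : 1 / (2 * σ ^ 2) * a ^ 2 + σ ^ 2 / 2 * 1 - -a = (a + σ ^ 2) ^ 2 / (2 * σ ^ 2) := by
        field_simp; ring
      have : 0 ≤ (a + σ ^ 2) ^ 2 / (2 * σ ^ 2) := by positivity
      linarith
  have hm := measurableSet_lt_norm_sub (d := d) R xstar
  have hii : Integrable (Set.indicator {z | R < ‖z - xstar‖} (fun _ => (1 : ℝ))) P :=
    (integrable_const 1).indicator hm
  have h1 := integral_mono (hdi.const_inner b)
    (((integrable_inner_sub_sq hP b).const_mul (1 / (2 * σ ^ 2))).add (hii.const_mul (σ ^ 2 / 2)))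
    hpt
  have h2 : ∫ z, (1 / (2 * σ ^ 2) * inner ℝ b (z - xstar) ^ 2
        + σ ^ 2 / 2 * Set.indicator {z | R < ‖z - xstar‖} (fun _ => (1 : ℝ)) z) ∂P
      = 1 / (2 * σ ^ 2) * ∫ z, inner ℝ b (z - xstar) ^ 2 ∂P + σ ^ 2 / 2 * q := by
    rw [integral_add ((integrable_inner_sub_sq hP b).const_mul _) (hii.const_mul _),
      integral_const_mul, integral_const_mul, integral_indicator_const _ hm, smul_eq_mul, mul_one]
  have h3 : 1 / (2 * σ ^ 2) * ∫ z, inner ℝ b (z - xstar) ^ 2 ∂P ≤ ‖b‖ ^ 2 / 2 := by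
    refine (mul_le_mul_of_nonneg_left (hV b) (by positivity)).trans (le_of_eq ?_)
    field_simp
  rw [← hbb] at h1
  have h4 := h1.trans_eq h2
  linarith

end Truncation

/-! ### Numerical bounds -/

section Numerics

open Real

lemma exp_two_fifths_le : exp (2 / 5) ≤ 3 / 2 := by
  have h1 : exp (2 / 5) ^ 5 ≤ (3 / 2) ^ 5 := by
    rw [← exp_nat_mul, show ((5 : ℕ) : ℝ) * (2 / 5) = (2 : ℕ) * 1 by norm_num, exp_nat_mul]
    have := exp_one_lt_d9
    have h0 := exp_pos 1
    nlinarith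
  exact (pow_le_pow_iff_left₀ (exp_pos _).le (by norm_num) (by norm_num)).1 h1

/-- The failure probability of the trace method with shift `3 n σ²` and level `(9/2) n σ²`, for the
exponent `⌈20 log d + 80⌉ + 1`. The factor `(2/3) ^ (N + 1)` is at most `exp (-0.4 (N + 1))`, the
expected growth of the trace at most `exp (0.35 (N + 1))`, and the remaining decay
`exp (-0.05 (N + 1))` absorbs the dimension `d`. -/
lemma chernoff_bound_le {d n : ℕ} (hd : 0 < d) (hn : 0 < n) {α : ℝ} (hα : 0 < α)
    (hαn : 160 * (3.2 * 10 ^ 4 * (d * log d) + 11.2 * 10 ^ 4 * d) ≤ α * n) {N : ℕ}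
    (hN : N = ⌈20 * log d + 80⌉₊) :
    (d : ℝ) * (2 / 3) ^ (N + 1)
      * (1 + (N + 1) * (1 + 16000 * d / (3 * (α * n))) ^ N * (1 / (3 * n))) ^ n ≤ 0.03 := by
  set L := log d with hL
  have hd1 : (1 : ℝ) ≤ d := by exact_mod_cast hd
  have hn0 : (0 : ℝ) < n := by exact_mod_cast hn
  have hL0 : 0 ≤ L := log_nonneg hd1
  have hN1 : 20 * L + 80 ≤ N := hN ▸ Nat.le_ceil _
  have hN2 : (N : ℝ) ≤ 20 * L + 81 := by
    have := Nat.ceil_lt_add_one (show 0 ≤ 20 * L + 80 by positivity)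
    rw [← hN] at this; linarith
  have hαn0 : 0 < α * n := by positivity
  set ρ := 16000 * d / (3 * (α * n)) with hρ
  have hρ0 : 0 ≤ ρ := by positivity
  have hρN : N * ρ ≤ 0.04 := by
    rw [hρ, mul_div_assoc', div_le_iff₀ (by positivity)]
    have h1 : (N : ℝ) * (16000 * d) ≤ (20 * L + 81) * (16000 * d) := by gcongr
    have h2 : 0 ≤ d * L := by positivity
    nlinarith
  have hpow : (1 + ρ) ^ N ≤ 1.05 := by
    have h1 : (1 + ρ) ^ N ≤ exp ρ ^ N :=
      pow_le_pow_left₀ (by positivity) (by linarith [add_one_le_exp ρ]) _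
    rw [← exp_nat_mul] at h1
    have h2 : exp (N * ρ) ≤ exp 0.04 := exp_le_exp.2 hρN
    have h3 : exp 0.04 ≤ 1.05 := by
      have h4 := add_one_le_exp (-0.04 : ℝ)
      rw [exp_neg] at h4
      have h5 := exp_pos (0.04 : ℝ)
      have h6 := mul_le_mul_of_nonneg_right h4 h5.le
      rw [inv_mul_cancel₀ h5.ne'] at h6
      linarith
    linarith
  have hfac : (1 + (N + 1) * (1 + ρ) ^ N * (1 / (3 * n))) ^ n ≤ exp (0.35 * (N + 1)) := by
    have h1 : (1 + (N + 1) * (1 + ρ) ^ N * (1 / (3 * n)))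
        ≤ exp ((N + 1) * (1 + ρ) ^ N * (1 / (3 * n))) := by
      rw [add_comm]; exact add_one_le_exp _
    refine (pow_le_pow_left₀ (by positivity) h1 n).trans ?_
    rw [← exp_nat_mul, exp_le_exp]
    have e : n * ((N + 1) * (1 + ρ) ^ N * (1 / (3 * (n : ℝ)))) = (N + 1) * ((1 + ρ) ^ N / 3) := by
      field_simp
    rw [e, mul_comm]
    gcongr
    linarith
  have h23 : ((2 : ℝ) / 3) ^ (N + 1) ≤ exp (-(2 / 5) * (N + 1)) := by
    have h1 : (2 : ℝ) / 3 ≤ exp (-(2 / 5)) := by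
      rw [exp_neg, show (2 : ℝ) / 3 = (3 / 2)⁻¹ by norm_num]
      exact inv_anti₀ (exp_pos _) exp_two_fifths_le
    refine (pow_le_pow_left₀ (by norm_num) h1 _).trans (le_of_eq ?_)
    rw [← exp_nat_mul]; push_cast; ring_nf
  have hdexp : (d : ℝ) = exp L := (exp_log (by linarith)).symm
  calc (d : ℝ) * (2 / 3) ^ (N + 1) * (1 + (N + 1) * (1 + ρ) ^ N * (1 / (3 * n))) ^ n
      ≤ exp L * exp (-(2 / 5) * (N + 1)) * exp (0.35 * (N + 1)) := by
        rw [← hdexp]; gcongr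
    _ = exp (L + -(2 / 5) * (N + 1) + 0.35 * (N + 1)) := by rw [exp_add, exp_add]
    _ ≤ exp (-4) := by rw [exp_le_exp]; linarith
    _ ≤ 0.03 := by
        rw [exp_neg]
        have h1 : (2.7 : ℝ) ^ 4 ≤ exp 4 := by
          rw [show (4 : ℝ) = (4 : ℕ) * 1 by norm_num, exp_nat_mul]
          exact pow_le_pow_left₀ (by norm_num) (by linarith [exp_one_gt_d9]) 4
        refine (inv_anti₀ (by positivity) h1).trans ?_
        norm_num

end Numerics

/-! ### Existence of a stable subset -/

section Sample

variable {d n : ℕ} {P : Measure (EuclideanSpace ℝ (Fin d))} [IsProbabilityMeasure P]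
  {xstar : EuclideanSpace ℝ (Fin d)} {σ α : ℝ}
  {Ω : Type*} [MeasurableSpace Ω] {μ : Measure Ω} [IsProbabilityMeasure μ]
  {ytilde : Fin n → Ω → EuclideanSpace ℝ (Fin d)}

omit [IsProbabilityMeasure P] [IsProbabilityMeasure μ] in
lemma integral_comp_sample {F : Type*} [NormedAddCommGroup F] [NormedSpace ℝ F]
    (hmeas : ∀ i, Measurable (ytilde i)) (hlaw : ∀ i, μ.map (ytilde i) = P)
    {f : EuclideanSpace ℝ (Fin d) → F} (hf : AEStronglyMeasurable f P) (i : Fin n) :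
    ∫ ω, f (ytilde i ω) ∂μ = ∫ z, f z ∂P := by
  rw [← hlaw i, integral_map (hmeas i).aemeasurable (by rwa [hlaw i])]

omit [IsProbabilityMeasure P] in
/-- Markov's inequality for the number of sample points farther than `R` from `xstar`. -/
lemma exists_event_card_far_le (hmeas : ∀ i, Measurable (ytilde i))
    (hlaw : ∀ i, μ.map (ytilde i) = P) (hα : 0 < α) (hn : 0 < n) {R : ℝ}
    (hq : P.real {z | R < ‖z - xstar‖} ≤ α / 16000) :
    ∃ A : Set Ω, MeasurableSet A ∧ μ.real A ≤ 0.01 ∧ ∀ ω ∉ A,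
      ((Finset.univ.filter fun i => ‖ytilde i ω - xstar‖ ≤ R)ᶜ.card : ℝ) ≤ α * n / 160 := by
  have hn' : (0 : ℝ) < n := by exact_mod_cast hn
  set E := {z : EuclideanSpace ℝ (Fin d) | R < ‖z - xstar‖} with hE
  have hEm : MeasurableSet E := measurableSet_lt_norm_sub R xstar
  set g : EuclideanSpace ℝ (Fin d) → ℝ := E.indicator fun _ => 1 with hg
  have hgm : Measurable g := measurable_const.indicator hEm
  have hg0 : ∀ z, 0 ≤ g z := fun z => Set.indicator_nonneg (fun _ _ => zero_le_one) z
  set f : Ω → ℝ := fun ω => ∑ i, g (ytilde i ω) with hf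
  have hfm : Measurable f := Finset.measurable_fun_sum _ fun i _ => hgm.comp (hmeas i)
  have hgi : ∀ i, Integrable (fun ω => g (ytilde i ω)) μ := fun i =>
    Integrable.of_bound (hgm.comp (hmeas i)).aestronglyMeasurable 1
      (Filter.Eventually.of_forall fun ω => by
        rw [Real.norm_of_nonneg (hg0 _)]
        exact Set.indicator_le_self' (f := fun _ => (1 : ℝ)) (fun _ _ => zero_le_one) _)
  have hint : ∫ ω, f ω ∂μ = n * P.real E := by
    rw [hf, integral_finsetSum _ fun i _ => hgi i]
    have : ∀ i, ∫ ω, g (ytilde i ω) ∂μ = P.real E := fun i => by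
      rw [integral_comp_sample hmeas hlaw hgm.aestronglyMeasurable i, hg,
        integral_indicator_const _ hEm, smul_eq_mul, mul_one]
    simp [this]
  have hcard : ∀ ω, f ω = ((Finset.univ.filter fun i => ‖ytilde i ω - xstar‖ ≤ R)ᶜ.card : ℝ) := by
    intro ω
    rw [Finset.compl_filter, Finset.card_filter, Nat.cast_sum]
    refine Finset.sum_congr rfl fun i _ => ?_
    simp [hg, hE, Set.indicator_apply]
  refine ⟨{ω | α * n / 160 ≤ f ω}, measurableSet_le measurable_const hfm, ?_, fun ω hω => ?_⟩
  · have h1 := mul_meas_ge_le_integral_of_nonneg (μ := μ) (f := f)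
      (Filter.Eventually.of_forall fun ω => Finset.sum_nonneg fun i _ => hg0 _)
      (integrable_finsetSum _ fun i _ => hgi i) (α * n / 160)
    rw [hint] at h1
    have h2 := mul_le_mul_of_nonneg_left hq hn'.le
    have h3 : 0 < α * n / 160 := by positivity
    refine le_of_mul_le_mul_left ?_ h3
    linarith
  · rw [← hcard]
    exact (not_le.1 hω).le

omit [IsProbabilityMeasure P] in
/-- The second moment of a sum of independent vectors with a common law: the variances add up,
and the bias enters once for each pair. -/
lemma integral_norm_sum_sq_le (hmeas : ∀ i, Measurable (ytilde i)) (hindep : iIndepFun ytilde μ)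
    (hlaw : ∀ i, μ.map (ytilde i) = P)
    {g : EuclideanSpace ℝ (Fin d) → EuclideanSpace ℝ (Fin d)} (hg : Measurable g) {R : ℝ}
    (hR : ∀ z, ‖g z‖ ≤ R) {V B : ℝ} (hV : ∫ z, ‖g z‖ ^ 2 ∂P ≤ V) (hB : ‖∫ z, g z ∂P‖ ^ 2 ≤ B) :
    Integrable (fun ω => ‖∑ i, g (ytilde i ω)‖ ^ 2) μ ∧
      ∫ ω, ‖∑ i, g (ytilde i ω)‖ ^ 2 ∂μ ≤ n * V + n ^ 2 * B := by
  have hzm : ∀ i, Measurable fun ω => g (ytilde i ω) := fun i => hg.comp (hmeas i)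
  have hzi : ∀ i, Integrable (fun ω => g (ytilde i ω)) μ := fun i =>
    Integrable.of_bound (hzm i).aestronglyMeasurable R (Filter.Eventually.of_forall fun ω => hR _)
  have hii : ∀ i j, Integrable (fun ω => inner ℝ (g (ytilde i ω)) (g (ytilde j ω))) μ := by
    intro i j
    refine Integrable.of_bound ((hzm i).inner (hzm j)).aestronglyMeasurable (R * R)
      (Filter.Eventually.of_forall fun ω => (norm_inner_le_norm _ _).trans ?_)
    exact mul_le_mul (hR _) (hR _) (norm_nonneg _) ((norm_nonneg _).trans (hR 0))
  have e : ∀ ω, ‖∑ i, g (ytilde i ω)‖ ^ 2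
      = ∑ i, ∑ j, inner ℝ (g (ytilde i ω)) (g (ytilde j ω)) := by
    intro ω
    rw [← real_inner_self_eq_norm_sq, sum_inner]
    simp only [inner_sum]
  simp only [e]
  refine ⟨integrable_finsetSum _ fun i _ => integrable_finsetSum _ fun j _ => hii i j, ?_⟩
  rw [integral_finsetSum _ fun i _ => integrable_finsetSum _ fun j _ => hii i j]
  have hB0 : 0 ≤ B := (sq_nonneg _).trans hB
  have hij : ∀ i j, ∫ ω, inner ℝ (g (ytilde i ω)) (g (ytilde j ω)) ∂μ
      ≤ (if i = j then V else 0) + B := by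
    intro i j
    by_cases h : i = j
    · subst h
      simp only [real_inner_self_eq_norm_sq, if_true]
      rw [integral_comp_sample hmeas hlaw (f := fun z => ‖g z‖ ^ 2)
        (hg.norm.pow_const 2).aestronglyMeasurable i]
      linarith
    · have hind := ((hindep.comp (fun _ => g) (fun _ => hg)).indepFun h)
      have h1 := hind.integral_bilin (hzi i) (hzi j) (innerSL ℝ)
      rw [if_neg h, zero_add]
      refine le_trans (le_of_eq (h1.trans ?_)) hB
      have hm : ∀ i, ∫ ω, ((fun _ => g) i ∘ ytilde i) ω ∂μ = ∫ z, g z ∂P := fun i =>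
        integral_comp_sample hmeas hlaw hg.aestronglyMeasurable i
      rw [hm, hm, innerSL_apply_apply, real_inner_self_eq_norm_sq]
  calc ∑ i, ∫ ω, ∑ j, inner ℝ (g (ytilde i ω)) (g (ytilde j ω)) ∂μ
      ≤ ∑ i : Fin n, ∑ j : Fin n, ((if i = j then V else 0) + B) := by
        refine Finset.sum_le_sum fun i _ => ?_
        rw [integral_finsetSum _ fun j _ => hii i j]
        exact Finset.sum_le_sum fun j _ => hij i j
    _ = n * V + n ^ 2 * B := by
        simp [Finset.sum_add_distrib]
        ring

/-- With the required sample size, all but a few percent of the samples contain a stable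
subset: the points within the truncation radius. -/
lemma exists_event_isStableSubset (hσ : 0 < σ) (hd : 0 < d) (hn : 0 < n) (hα : 0 < α)
    (hP : MemLp (fun z : EuclideanSpace ℝ (Fin d) => z) 2 P) (hmean : ∫ z, z ∂P = xstar)
    (hV : ∀ v, ∫ z, inner ℝ v (z - xstar) ^ 2 ∂P ≤ σ ^ 2 * ‖v‖ ^ 2)
    (hαn : 160 * (3.2 * 10 ^ 4 * (d * Real.log d) + 11.2 * 10 ^ 4 * d) ≤ α * n)
    (hmeas : ∀ i, Measurable (ytilde i)) (hindep : iIndepFun ytilde μ)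
    (hlaw : ∀ i, μ.map (ytilde i) = P) :
    ∃ A : Set Ω, MeasurableSet A ∧ 0.949 ≤ μ.real A ∧
      ∀ ω ∈ A, ∃ S, IsStableSubset α σ xstar (fun i => ytilde i ω) S := by
  have hn' : (0 : ℝ) < n := by exact_mod_cast hn
  have hd1 : (1 : ℝ) ≤ d := by exact_mod_cast hd
  have hd' : (0 : ℝ) < d := by linarith
  -- each point is truncated with probability at most `α / 16000`, a hundredth of `α / 160`
  set R := √(16000 * d * σ ^ 2 / α) with hR
  have hR2 : R ^ 2 = 16000 * d * σ ^ 2 / α := Real.sq_sqrt (by positivity)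
  have hR0 : 0 ≤ R := Real.sqrt_nonneg _
  set q := P.real {z | R < ‖z - xstar‖} with hq
  have hq1 : q ≤ α / 16000 := by
    have h1 := sq_mul_measureReal_lt_norm_sub_le hP hV hR0
    have h2 : 0 < 16000 * d * σ ^ 2 / α := by positivity
    rw [hR2] at h1
    refine le_of_mul_le_mul_left (h1.trans (le_of_eq ?_)) h2
    field_simp
  set g : EuclideanSpace ℝ (Fin d) → EuclideanSpace ℝ (Fin d) := fun z => truncate R (z - xstar)
    with hg
  have hgm : Measurable g := measurable_truncate_sub R xstar
  have hgR : ∀ z, ‖g z‖ ≤ R := fun z => norm_truncate_le hR0 _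
  have hgv : ∀ v, ∫ z, inner ℝ v (g z) ^ 2 ∂P ≤ σ ^ 2 * ‖v‖ ^ 2 := fun v =>
    (integral_mono_of_nonneg (Filter.Eventually.of_forall fun z => sq_nonneg _)
      (integrable_inner_sub_sq hP v)
      (Filter.Eventually.of_forall fun z => inner_truncate_sq_le R v (z - xstar))).trans (hV v)
  have hgV : ∫ z, ‖g z‖ ^ 2 ∂P ≤ d * σ ^ 2 :=
    (integral_mono_of_nonneg (Filter.Eventually.of_forall fun z => sq_nonneg _)
      (integrable_norm_sub_sq hP)
      (Filter.Eventually.of_forall fun z => pow_le_pow_left₀ (norm_nonneg _)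
        (norm_truncate_le_norm R (z - xstar)) 2)).trans (integral_norm_sub_sq_le hP hV)
  have hgB : ‖∫ z, g z ∂P‖ ^ 2 ≤ α / 16000 * σ ^ 2 :=
    (norm_integral_truncate_sq_le hP hmean hσ hV hR0).trans
      (mul_le_mul_of_nonneg_right hq1 (sq_nonneg _))
  -- few points are truncated
  obtain ⟨A₁, hA₁m, hA₁, hA₁'⟩ := exists_event_card_far_le hmeas hlaw hα hn hq1
  -- the truncated deviations nearly cancel
  obtain ⟨hfi, hfle⟩ := integral_norm_sum_sq_le hmeas hindep hlaw hgm hgR hgV hgB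
  set f : Ω → ℝ := fun ω => ‖∑ i, g (ytilde i ω)‖ ^ 2 with hf
  set A₂ := {ω | 0.49 * n ^ 2 * σ ^ 2 * α ≤ f ω} with hA₂
  have hA₂m : MeasurableSet A₂ := measurableSet_le measurable_const
    ((Finset.measurable_fun_sum _ fun i _ => hgm.comp (hmeas i)).norm.pow_const 2)
  have hA₂le : μ.real A₂ ≤ 0.01 := by
    have h1 := (mul_meas_ge_le_integral_of_nonneg (μ := μ) (f := f)
      (Filter.Eventually.of_forall fun ω => sq_nonneg _) hfi (0.49 * n ^ 2 * σ ^ 2 * α)).trans hfle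
    have h2 : 0 < 0.49 * n ^ 2 * σ ^ 2 * α := by positivity
    refine le_of_mul_le_mul_left (h1.trans ?_) h2
    have h3 : 1000 * (d : ℝ) ≤ α * n := by
      have : 0 ≤ d * Real.log d := mul_nonneg hd'.le (Real.log_nonneg hd1)
      linarith
    have h4 := mul_le_mul_of_nonneg_left h3 (show 0 ≤ n * σ ^ 2 by positivity)
    have h5 : 0 ≤ n ^ 2 * σ ^ 2 * α := by positivity
    nlinarith
  -- the Gram matrix of the truncated deviations is bounded; the level `4.5 n σ²` exceeds the shift
  -- by `1.5 n σ²`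
  set z : Fin n → Ω → Fin d → ℝ := fun i ω => WithLp.ofLp (g (ytilde i ω)) with hz
  have hgz : Measurable fun w => WithLp.ofLp (g w) := (WithLp.measurable_ofLp 2 _).comp hgm
  have hzm : ∀ i, Measurable (z i) := fun i => hgz.comp (hmeas i)
  have hzind : iIndepFun z μ := hindep.comp (fun _ w => WithLp.ofLp (g w)) fun _ => hgz
  set u := 3 * n * σ ^ 2 with hu
  have hu0 : 0 < u := by positivity
  set ρ := 16000 * d / (3 * (α * n)) with hρ
  have hinner : ∀ (v : Fin d → ℝ) i ω,
      v ⬝ᵥ z i ω = inner ℝ (WithLp.toLp 2 v) (g (ytilde i ω)) := by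
    intro v i ω
    rw [EuclideanSpace.inner_eq_star_dotProduct, dotProduct_comm]
    rfl
  have hnorm : ∀ v : Fin d → ℝ, v ⬝ᵥ v = ‖(WithLp.toLp 2 v : EuclideanSpace ℝ (Fin d))‖ ^ 2 := by
    intro v
    rw [← real_inner_self_eq_norm_sq, EuclideanSpace.inner_eq_star_dotProduct]
    rfl
  have hzb : ∀ i ω, z i ω ⬝ᵥ z i ω ≤ ρ * u := by
    intro i ω
    rw [hnorm]
    refine (pow_le_pow_left₀ (norm_nonneg _) (hgR (ytilde i ω)) 2).trans (le_of_eq ?_)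
    rw [hR2, hρ, hu]
    field_simp
  have hzv : ∀ i (v : Fin d → ℝ), ∫ ω, (v ⬝ᵥ z i ω) ^ 2 ∂μ ≤ σ ^ 2 * (v ⬝ᵥ v) := by
    intro i v
    simp only [hinner]
    rw [hnorm, integral_comp_sample hmeas hlaw
      (f := fun w => inner ℝ (WithLp.toLp 2 v) (g w) ^ 2)
      ((measurable_const.inner hgm).pow_const 2).aestronglyMeasurable i]
    exact hgv _
  set N := ⌈20 * Real.log d + 80⌉₊ with hN
  obtain ⟨A₃, hA₃m, hA₃, hA₃'⟩ := measureReal_trace_pow_ge_le (T := 4.5 * n * σ ^ 2) hzm hzind hu0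
    (by positivity) (sq_nonneg σ) (by positivity) hzb hzv N
  have hA₃le : μ.real A₃ ≤ 0.03 := by
    refine hA₃.trans (le_trans (le_of_eq ?_) (chernoff_bound_le hd hn hα hαn hN))
    have e1 : u / (4.5 * n * σ ^ 2) = 2 / 3 := by rw [hu]; field_simp; norm_num
    have e2 : σ ^ 2 / u = 1 / (3 * n) := by rw [hu]; field_simp
    rw [e1, e2, Fintype.card_fin, Fintype.card_fin]
  have hbad : μ.real (A₁ ∪ A₂ ∪ A₃) ≤ 0.05 := by
    have h1 := measureReal_union_le (μ := μ) (A₁ ∪ A₂) A₃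
    have h2 := measureReal_union_le (μ := μ) A₁ A₂
    linarith
  have hbadm : MeasurableSet (A₁ ∪ A₂ ∪ A₃) := (hA₁m.union hA₂m).union hA₃m
  refine ⟨(A₁ ∪ A₂ ∪ A₃)ᶜ, hbadm.compl, ?_, fun ω hω => ?_⟩
  · rw [probReal_compl_eq_one_sub hbadm]; linarith
  simp only [Set.mem_compl_iff, Set.mem_union, not_or] at hω
  obtain ⟨⟨hω₁, hω₂⟩, hω₃⟩ := hω
  refine ⟨Finset.univ.filter fun i => ‖ytilde i ω - xstar‖ ≤ R, hA₁' ω hω₁, fun v => ?_, ?_⟩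
  · have h := hA₃' ω hω₃ (WithLp.ofLp v)
    simp only [hinner, hnorm] at h
    have e : ∀ i ∈ Finset.univ.filter fun i => ‖ytilde i ω - xstar‖ ≤ R,
        inner ℝ v (ytilde i ω - xstar) ^ 2 = inner ℝ v (g (ytilde i ω)) ^ 2 := by
      intro i hi
      rw [hg]; simp only [truncate]
      rw [if_pos (Finset.mem_filter.1 hi).2]
    rw [Finset.sum_congr rfl e]
    refine (Finset.sum_le_sum_of_subset_of_nonneg (Finset.filter_subset _ _)
      fun i _ _ => sq_nonneg _).trans (h.trans (le_of_eq ?_))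
    rw [hu, WithLp.toLp_ofLp]; ring
  · have e : ∑ i ∈ Finset.univ.filter (fun i => ‖ytilde i ω - xstar‖ ≤ R), (ytilde i ω - xstar)
        = ∑ i, g (ytilde i ω) := by
      rw [Finset.sum_filter]
      rfl
    rw [e]
    refine (pow_le_pow_iff_left₀ (norm_nonneg _) (by positivity) two_ne_zero).1 ?_
    refine (not_le.1 hω₂).le.trans (le_of_eq ?_)
    rw [mul_pow _ (√α), Real.sq_sqrt hα.le]; ring

/-- Without variance every sample point equals the mean almost surely. -/
lemma exists_event_isStableSubset_of_zero (hα : 0 ≤ α)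
    (hP : MemLp (fun z : EuclideanSpace ℝ (Fin d) => z) 2 P)
    (hV : ∀ v, ∫ z, inner ℝ v (z - xstar) ^ 2 ∂P ≤ (0 : ℝ) ^ 2 * ‖v‖ ^ 2)
    (hmeas : ∀ i, Measurable (ytilde i)) (hlaw : ∀ i, μ.map (ytilde i) = P) :
    ∃ A : Set Ω, MeasurableSet A ∧ 0.949 ≤ μ.real A ∧
      ∀ ω ∈ A, ∃ S, IsStableSubset α 0 xstar (fun i => ytilde i ω) S := by
  have h0 : ∫ z, ‖z - xstar‖ ^ 2 ∂P = 0 :=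
    le_antisymm (by simpa using integral_norm_sub_sq_le hP hV)
      (integral_nonneg fun z => sq_nonneg _)
  have hae : ∀ᵐ z ∂P, z = xstar := by
    have := (integral_eq_zero_iff_of_nonneg (fun z => sq_nonneg _) (integrable_norm_sub_sq hP)).1 h0
    filter_upwards [this] with z hz
    simpa [sub_eq_zero] using hz
  have hae' : ∀ᵐ ω ∂μ, ∀ i, ytilde i ω = xstar := by
    rw [ae_all_iff]
    intro i
    rw [← hlaw i] at hae
    exact ae_of_ae_map (hmeas i).aemeasurable hae
  have hm : MeasurableSet {ω | ∀ i, ytilde i ω = xstar} := by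
    rw [Set.ofPred_forall]
    exact MeasurableSet.iInter fun i => measurableSet_eq_fun (hmeas i) measurable_const
  refine ⟨_, hm, ?_, fun ω hω => ⟨Finset.univ, ?_, fun v => ?_, ?_⟩⟩
  · have h1 : μ {ω | ∀ i, ytilde i ω = xstar} = 1 := (mem_ae_iff_prob_eq_one hm).1 hae'
    rw [measureReal_def, h1]; norm_num
  · simp; positivity
  · simp [show ∀ i, ytilde i ω = xstar from hω]
  · simp [show ∀ i, ytilde i ω = xstar from hω]

end Sample

end RobustMean

theorem corollary1 {d n : ℕ}
    (P : Measure (EuclideanSpace ℝ (Fin d))) [IsProbabilityMeasure P]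
    (xstar : EuclideanSpace ℝ (Fin d)) (σ α c₁ : ℝ)
    (hσ : 0 ≤ σ)
    -- `P` has finite second moments, mean `xstar` and covariance matrix `≼ σ² I`
    (hP : MemLp (fun z : EuclideanSpace ℝ (Fin d) => z) 2 P)
    (hmean : ∫ z, z ∂P = xstar)
    (hcov : (σ ^ 2 • (1 : Matrix (Fin d) (Fin d) ℝ) - RobustMean.covMatrix P).PosSemidef)
    (hα : 0 < α) (hα' : α ≤ 0.33)
    (hc₁ : 0 ≤ c₁) (hc₁' : 3 / 2 ≤ c₁ ^ 2)
    (hn : 3.2 * 10 ^ 4 * 160 * (d * Real.log d / α) + 11.2 * 10 ^ 4 * 160 * (d / α) ≤ (n : ℝ))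
    -- `ytilde` are `n` independent samples from `P`
    {Ω : Type*} [MeasurableSpace Ω] (μ : Measure Ω) [IsProbabilityMeasure μ]
    (ytilde : Fin n → Ω → EuclideanSpace ℝ (Fin d))
    (hmeas : ∀ i, Measurable (ytilde i))
    (hindep : iIndepFun ytilde μ)
    (hlaw : ∀ i, μ.map (ytilde i) = P) :
    -- an event of probability at least `0.949` on which the bounds hold whatever the adversary,
    -- who has seen all the samples, does
    ∃ A : Set Ω, MeasurableSet A ∧ 0.949 ≤ μ.real A ∧
      ∀ ω ∈ A, ∀ y : Fin n → EuclideanSpace ℝ (Fin d),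
        RobustMean.IsCorruption α (fun i => ytilde i ω) y →
        (∀ (hopt : Fin n → ℝ) (xopt : EuclideanSpace ℝ (Fin d)),
          RobustMean.IsGlobalOpt c₁ σ y hopt xopt → RobustMean.IsBinary hopt →
          xopt = RobustMean.inlierMean y hopt →
          ‖xopt - xstar‖ ≤ (7.5 + 3.1 * c₁) * σ * √α) ∧
        (∀ (hhat : Fin n → ℝ) (xhat : EuclideanSpace ℝ (Fin d)),
          RobustMean.IsFeasible c₁ σ y hhat xhat → RobustMean.IsBinary hhat →
          xhat = RobustMean.inlierMean y hhat →
          (hammingNorm hhat : ℝ) ≤ 161 / 160 * α * n →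
          ‖xhat - xstar‖ ≤ (7.5 + 3.1 * c₁) * σ * √α) := by
  have hV := RobustMean.integral_inner_sub_sq_le hP hmean hcov
  rcases Nat.eq_zero_or_pos d with rfl | hd
  · -- in dimension zero every norm vanishes
    have h0 : ∀ x : EuclideanSpace ℝ (Fin 0), ‖x - xstar‖ ≤ (7.5 + 3.1 * c₁) * σ * √α := fun x => by
      rw [Subsingleton.elim (x - xstar) 0, norm_zero]
      positivity
    exact ⟨Set.univ, MeasurableSet.univ, by rw [probReal_univ]; norm_num, fun ω _ y _ =>
      ⟨fun _ x _ _ _ => h0 x, fun _ x _ _ _ _ => h0 x⟩⟩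
  have hd1 : (1 : ℝ) ≤ d := by exact_mod_cast hd
  have hαn : 160 * (3.2 * 10 ^ 4 * (d * Real.log d) + 11.2 * 10 ^ 4 * d) ≤ α * n := by
    refine le_trans (le_of_eq ?_) (mul_le_mul_of_nonneg_left hn hα.le)
    field_simp
  have hn0 : 0 < n := by
    have : 0 ≤ d * Real.log d := mul_nonneg (by linarith) (Real.log_nonneg hd1)
    have h1 : 0 < α * n := by linarith
    exact_mod_cast pos_of_mul_pos_right h1 hα.le
  obtain ⟨A, hAm, hA, hAS⟩ : ∃ A : Set Ω, MeasurableSet A ∧ 0.949 ≤ μ.real A ∧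
      ∀ ω ∈ A, ∃ S, RobustMean.IsStableSubset α σ xstar (fun i => ytilde i ω) S := by
    rcases hσ.eq_or_lt with rfl | hσ0
    · exact RobustMean.exists_event_isStableSubset_of_zero hα.le hP hV hmeas hlaw
    · exact RobustMean.exists_event_isStableSubset hσ0 hd hn0 hα hP hmean hV hαn hmeas hindep hlaw
  refine ⟨A, hAm, hA, fun ω hω y hcor => ?_⟩
  obtain ⟨S, hS⟩ := hAS ω hω
  have key : ∀ (h : Fin n → ℝ) (x : EuclideanSpace ℝ (Fin d)),
      RobustMean.IsFeasible c₁ σ y h x → RobustMean.IsBinary h → x = RobustMean.inlierMean y h →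
      (hammingNorm h : ℝ) ≤ 161 / 160 * α * n → ‖x - xstar‖ ≤ (7.5 + 3.1 * c₁) * σ * √α :=
    fun h x hf hb hx hc => hS.norm_inlierMean_sub_le hd hn0 hσ hα hα' hc₁ hcor hf hb hx hc
  exact ⟨fun h x ho hb hx => key h x ho.1 hb hx (hS.hammingNorm_le hd hc₁' hcor ho), key⟩
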